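/- Let $(M,g)$ be a compact smooth Riemannian manifold without boundary, let $(N,\omega)$ be a smooth symplectic manifold without boundary, and for a smooth map $\varphi:M\to N$ put $$F(\varphi)=\frac12\int_M\|\varphi^*\omega\|^2\,\mathrm{vol}_g ,$$ where $\|\cdot\|$ is the pointwise norm on 2-forms induced by $g$ and $\mathrm{vol}_g$ is the Riemannian volume measure. Let $\varphi:M\to N$ be a smooth map such that $\varphi^*\omega$ is coclosed, i.e. $\delta(\varphi^*\omega)=0$, where $\delta$ is the coderivative of $(M,g)$. Then $\varphi$ minimizes $F$ in its homotopy class: $F(\varphi)\le F(\psi)$ for every smooth map $\psi:M\to N$ homotopic to $\varphi$. -/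

import Mathlib

open scoped Manifold ContDiff

noncomputable section

namespace SymplecticDirichlet

/-- A (not necessarily smooth) differential `k`-form on an `n`-dimensional manifold `M`: an
alternating `k`-linear form on every tangent space. -/
abbrev DiffForm (n : ℕ) (M : Type*) [TopologicalSpace M]
    [ChartedSpace (EuclideanSpace ℝ (Fin n)) M] (k : ℕ) : Type _ :=
  ∀ x : M, TangentSpace (𝓡 n) x [⋀^Fin k]→L[ℝ] ℝ

/-- A smooth Riemannian metric on the `n`-dimensional manifold `M`. -/
abbrev RiemannianMetric (n : ℕ) (M : Type*) [TopologicalSpace M]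
    [ChartedSpace (EuclideanSpace ℝ (Fin n)) M] [IsManifold (𝓡 n) ∞ M] : Type _ :=
  Bundle.ContMDiffRiemannianMetric (𝓡 n) ∞ (EuclideanSpace ℝ (Fin n))
    (fun x : M ↦ TangentSpace (𝓡 n) x)

section Forms

variable {n : ℕ} {M : Type*} [TopologicalSpace M] [ChartedSpace (EuclideanSpace ℝ (Fin n)) M]

/-- The differential at `y` of the inverse `χ⁻¹` of the chart `χ` at `c`, from `ℝⁿ` to the
tangent space of `M` at `χ⁻¹ y`. -/
def chartInvDeriv (c : M) (y : EuclideanSpace ℝ (Fin n)) :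
    EuclideanSpace ℝ (Fin n) →L[ℝ]
      TangentSpace (𝓡 n) ((chartAt (EuclideanSpace ℝ (Fin n)) c).symm y) :=
  mfderiv (𝓡 n) (𝓡 n) (chartAt (EuclideanSpace ℝ (Fin n)) c).symm y

/-- The expression `(χ⁻¹)^* α` of the form `α` in the chart `χ` at `c`. It is meaningful on the
target of the chart. -/
def DiffForm.inChart {k : ℕ} (α : DiffForm n M k) (c : M) (y : EuclideanSpace ℝ (Fin n)) :
    EuclideanSpace ℝ (Fin n) [⋀^Fin k]→L[ℝ] ℝ :=
  (α ((chartAt (EuclideanSpace ℝ (Fin n)) c).symm y)).compContinuousLinearMap (chartInvDeriv c y)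

/-- A form is smooth if its expression in every chart of the atlas is smooth. -/
def DiffForm.IsSmooth {k : ℕ} (α : DiffForm n M k) : Prop :=
  ∀ c : M, ContDiffOn ℝ ∞ (α.inChart c) (chartAt (EuclideanSpace ℝ (Fin n)) c).target

/-- A form is closed if the exterior derivative of its expression in every chart of the atlas
vanishes. -/
def DiffForm.IsClosed {k : ℕ} (α : DiffForm n M k) : Prop :=
  ∀ c : M, ∀ y ∈ (chartAt (EuclideanSpace ℝ (Fin n)) c).target, extDeriv (α.inChart c) y = 0

/-- The pullback `φ^* α` of a form along a map. -/
def DiffForm.pullback {m : ℕ} {L : Type*} [TopologicalSpace L]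
    [ChartedSpace (EuclideanSpace ℝ (Fin m)) L] {k : ℕ} (φ : L → M) (α : DiffForm n M k) :
    DiffForm m L k :=
  fun x ↦ (α (φ x)).compContinuousLinearMap (mfderiv (𝓡 m) (𝓡 n) φ x)

end Forms

/-- A symplectic form: a smooth, closed, nondegenerate 2-form. -/
structure SymplecticForm (n : ℕ) (N : Type*) [TopologicalSpace N]
    [ChartedSpace (EuclideanSpace ℝ (Fin n)) N] where
  /-- The underlying 2-form. -/
  form : DiffForm n N 2
  isSmooth : form.IsSmooth
  isClosed : form.IsClosed
  nondegenerate : ∀ (p : N) (v : TangentSpace (𝓡 n) p), (∀ w, form p ![v, w] = 0) → v = 0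

section Riemannian

variable {m : ℕ} {M : Type*} [TopologicalSpace M] [ChartedSpace (EuclideanSpace ℝ (Fin m)) M]

/-- The components `α(b i, b j)` of a 2-form at `x` in a frame `b` of the tangent space. -/
def DiffForm.components (α : DiffForm m M 2) (x : M) (b : Fin m → TangentSpace (𝓡 m) x) :
    Matrix (Fin m) (Fin m) ℝ :=
  Matrix.of fun i j ↦ α x ![b i, b j]

/-- The coordinate frame `∂₁, …, ∂ₘ` of the chart at `c`, over the point with coordinates `y`. -/
def coordFrame (c : M) (y : EuclideanSpace ℝ (Fin m)) (i : Fin m) :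
    TangentSpace (𝓡 m) ((chartAt (EuclideanSpace ℝ (Fin m)) c).symm y) :=
  chartInvDeriv c y (EuclideanSpace.single i 1)

/-- A basis of the tangent space at `x` (the one given by the preferred chart at `x`). -/
def tangentFrame (x : M) (i : Fin m) : TangentSpace (𝓡 m) x :=
  (EuclideanSpace.single i 1 : EuclideanSpace ℝ (Fin m))

/-- Raising both indices of a 2-form with components `A` with respect to the metric with
components `G`: the matrix `α^{ij} = ∑ a b, g^{ia} α_{ab} g^{bj}`. -/
def raise (G A : Matrix (Fin m) (Fin m) ℝ) : Matrix (Fin m) (Fin m) ℝ :=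
  G⁻¹ * A * G⁻¹

variable [IsManifold (𝓡 m) ∞ M] (g : RiemannianMetric m M)

/-- The components `g(b i, b j)` of the metric at `x` in a frame `b` of the tangent space. -/
def gram (x : M) (b : Fin m → TangentSpace (𝓡 m) x) : Matrix (Fin m) (Fin m) ℝ :=
  Matrix.of fun i j ↦ g.inner x (b i) (b j)

/-- The components `g_{ij}` of the metric in the chart at `c`, at the point with coordinates
`y`. -/
def metricCoord (c : M) (y : EuclideanSpace ℝ (Fin m)) : Matrix (Fin m) (Fin m) ℝ :=
  gram g ((chartAt (EuclideanSpace ℝ (Fin m)) c).symm y) (coordFrame c y)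

/-- The Riemannian volume density `√ det g_{ij}` in the chart at `c`. -/
def volDensity (c : M) (y : EuclideanSpace ℝ (Fin m)) : ℝ :=
  √ (metricCoord g c y).det

/-- The squared norm `‖α‖² = ½ ∑ i j, α_{ij} α^{ij}` of a 2-form at `x`. It does not depend on the
frame used to compute it; in an orthonormal frame it equals `∑ i < j, (α_{ij})²`. -/
def normSq (α : DiffForm m M 2) (x : M) : ℝ :=
  (1 / 2) * ∑ i, ∑ j, α.components x (tangentFrame x) i j *
    raise (gram g x (tangentFrame x)) (α.components x (tangentFrame x)) i j

/-- The measure `√ det g_{ij} dy¹ … dyᵐ` carried by the domain of the chart at `c`. -/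
def chartVolume [MeasurableSpace M] (c : M) : MeasureTheory.Measure M :=
  ((MeasureTheory.volume.restrict (chartAt (EuclideanSpace ℝ (Fin m)) c).target).withDensity
    fun y ↦ ENNReal.ofReal (volDensity g c y)).map (chartAt (EuclideanSpace ℝ (Fin m)) c).symm

/-- The Riemannian volume measure. The measures `chartVolume g c` agree on overlaps of chart
domains, and their least upper bound is the measure which restricts to `chartVolume g c` on the
domain of each chart (for `M` compact, or more generally second countable). -/
def riemannianVolume [MeasurableSpace M] : MeasureTheory.Measure M :=
  ⨆ c : M, chartVolume g c

/-- The components `α^{ij}`, with indices raised, of a 2-form in the chart at `c`. -/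
def raisedCoord (α : DiffForm m M 2) (c : M) (y : EuclideanSpace ℝ (Fin m)) :
    Matrix (Fin m) (Fin m) ℝ :=
  raise (metricCoord g c y)
    (α.components ((chartAt (EuclideanSpace ℝ (Fin m)) c).symm y) (coordFrame c y))

/-- The `k`-th component, in the chart at `c`, of the coderivative `δα` of a 2-form:
`(δα)_k = - ∑ i j, g_{kj} (1 / √ det g) ∂_i (√ det g α^{ij})`. -/
def coderivCoord (α : DiffForm m M 2) (c : M) (y : EuclideanSpace ℝ (Fin m)) (k : Fin m) : ℝ :=
  -∑ j, metricCoord g c y k j * ((volDensity g c y)⁻¹ *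
    ∑ i, fderiv ℝ (fun z ↦ volDensity g c z * raisedCoord g α c z i j) y
      (EuclideanSpace.single i 1))

/-- A 2-form `α` is coclosed if `δα = 0`, that is, if all the components of `δα` vanish in every
chart of the atlas. -/
def IsCoclosed (α : DiffForm m M 2) : Prop :=
  ∀ c : M, ∀ y ∈ (chartAt (EuclideanSpace ℝ (Fin m)) c).target, ∀ k, coderivCoord g α c y k = 0

/-- The functional `F(φ) = ½ ∫_M ‖φ^* Ω‖²`. -/
def energy [MeasurableSpace M] {n : ℕ} {N : Type*} [TopologicalSpace N]
    [ChartedSpace (EuclideanSpace ℝ (Fin n)) N] (Ω : SymplecticForm n N) (φ : M → N) : ℝ :=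
  (1 / 2) * ∫ x, normSq g (Ω.form.pullback φ) x ∂(riemannianVolume g)

end Riemannian

end SymplecticDirichlet

end

/-! The minimization is the Hilbert space fact that a vector orthogonal to a displacement cannot be
shortened by it. Expanding `0 ≤ ‖ψ^*ω - φ^*ω‖²` gives `‖φ^*ω‖² + 2⟨φ^*ω, ψ^*ω - φ^*ω⟩ ≤ ‖ψ^*ω‖²`
(`normSq_add_le`), so it suffices that the cross term integrates to zero. Classically, `ψ^*ω - φ^*ω`
is exact for homotopic maps, and a coclosed form is L²-orthogonal to exact forms.

Here the global primitive is replaced by local ones, which also accommodates homotopies that are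
merely continuous. Fix `φ` and put `T(f) = ∫ ⟨φ^*ω, f^*ω⟩`. Suppose that `f` and `f'` differ only on
a compact subset of a chart domain which both send into one coordinate ball. The Poincaré lemma
(`exists_primitive_of_closed`) provides a primitive `l` of `ω` on that ball, and `f^*ω - f'^*ω` is
locally the differential of `f^*l - f'^*l`, a 1-form with compact support in the chart. Integration
by parts (`integral_divergenceFree_mul_fderiv_eq_zero`) then gives `T(f) = T(f')`; this is
`integral_formInner_pullback_eq`.

The rest is topology of the mapping space. Smooth maps sufficiently close, in the compact-open
topology, to a given continuous map are linked by finitely many such local moves, so they share the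
same value of `T` (`exists_nhds_eq`). Smooth maps are dense (`exists_contMDiff_mem_nhds`). Hence
`T`, evaluated on smooth approximations of the stages of a homotopy, is locally constant in time,
and connectedness of the unit interval finishes the argument (`eq_of_homotopic`). -/

set_option maxSynthPendingDepth 3

noncomputable section

namespace SymplecticDirichlet

open Set Filter Topology MeasureTheory

/-! ### Calculus on a normed space: the Poincaré lemma and pullback of 1-forms. -/

section Euclidean

variable {E F : Type*} [NormedAddCommGroup E] [NormedSpace ℝ E]
  [NormedAddCommGroup F] [NormedSpace ℝ F]

/-- A continuous alternating 2-form as a continuous bilinear map. -/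
def bilinOfForm : (E [⋀^Fin 2]→L[ℝ] ℝ) →L[ℝ] E →L[ℝ] E →L[ℝ] ℝ :=
  (ContinuousLinearMap.compL ℝ E (ContinuousMultilinearMap ℝ (fun _ : Fin 1 ↦ E) ℝ) (E →L[ℝ] ℝ)
      ((continuousMultilinearCurryFin1 ℝ E ℝ).toContinuousLinearEquiv : _ →L[ℝ] _)) ∘L
    ((continuousMultilinearCurryLeftEquiv ℝ (fun _ : Fin 2 ↦ E) ℝ).toContinuousLinearEquiv :
      _ →L[ℝ] _) ∘L ContinuousAlternatingMap.toContinuousMultilinearMapCLM ℝ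

@[simp]
lemma bilinOfForm_apply (η : E [⋀^Fin 2]→L[ℝ] ℝ) (u v : E) :
    bilinOfForm η u v = η ![u, v] := by
  simp [bilinOfForm]

lemma contDiff_bilinOfForm {n : WithTop ℕ∞} :
    ContDiff ℝ n fun η : E [⋀^Fin 2]→L[ℝ] ℝ ↦ bilinOfForm η := by
  fun_prop

lemma hasFDerivAt_bilinOfForm (η : E [⋀^Fin 2]→L[ℝ] ℝ) :
    HasFDerivAt (fun θ : E [⋀^Fin 2]→L[ℝ] ℝ ↦ bilinOfForm θ) bilinOfForm η :=
  ContinuousLinearMap.hasFDerivAt (F := E →L[ℝ] E →L[ℝ] ℝ) bilinOfForm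

lemma alternating_two_swap (η : E [⋀^Fin 2]→L[ℝ] ℝ) (u v : E) : η ![u, v] = -η ![v, u] := by
  have h := η.map_swap ![v, u] (i := 0) (j := 1) (by simp)
  have e : (![v, u] ∘ ⇑(Equiv.swap (0 : Fin 2) 1)) = ![u, v] := by
    ext i
    fin_cases i <;> rfl
  rw [e] at h
  exact h

/-- A `C¹` function on an open set, vanishing off a relatively closed part, extends by zero. -/
lemma contDiff_indicator {f : E → F} {n : WithTop ℕ∞} {S K : Set E} (hS : IsOpen S)
    (hK : IsClosed K) (hKS : K ⊆ S) (hf : ContDiffOn ℝ n f S) (h0 : ∀ y ∈ S, y ∉ K → f y = 0) :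
    ContDiff ℝ n (S.indicator f) := by
  rw [contDiff_iff_contDiffAt]
  intro y
  by_cases hy : y ∈ S
  · refine (hf.contDiffAt (hS.mem_nhds hy)).congr_of_eventuallyEq ?_
    filter_upwards [hS.mem_nhds hy] with z hz using indicator_of_mem hz f
  · refine contDiffAt_const (c := (0 : F)) |>.congr_of_eventuallyEq ?_
    filter_upwards [hK.isOpen_compl.mem_nhds (fun h ↦ hy (hKS h))] with z hz
    by_cases hzS : z ∈ S
    · rw [indicator_of_mem hzS, h0 z hzS hz]
    · exact indicator_of_notMem hzS f

variable [FiniteDimensional ℝ E]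

/-- Differentiation under the integral sign over the unit interval. -/
lemma hasFDerivAt_intervalIntegral {f : E × ℝ → F} [CompleteSpace F] (hf : ContDiff ℝ 1 f) (x : E) :
    HasFDerivAt (fun y ↦ ∫ t in (0 : ℝ)..1, f (y, t))
      (∫ t in (0 : ℝ)..1, (fderiv ℝ f (x, t)).comp (ContinuousLinearMap.inl ℝ E ℝ)) x := by
  have hf' : Continuous fun p : E × ℝ ↦ (fderiv ℝ f p).comp (ContinuousLinearMap.inl ℝ E ℝ) :=
    (hf.continuous_fderiv one_ne_zero).clm_comp continuous_const
  obtain ⟨C, hC⟩ := ((isCompact_closedBall x 1).prod (isCompact_Icc (a := (0 : ℝ)) (b := 1))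
    |>.image hf'.norm).bddAbove
  refine intervalIntegral.hasFDerivAt_integral_of_dominated_of_fderiv_le (𝕜 := ℝ)
    (F' := fun y t ↦ (fderiv ℝ f (y, t)).comp (ContinuousLinearMap.inl ℝ E ℝ))
    (bound := fun _ ↦ C) (Metric.closedBall_mem_nhds x one_pos) ?_ ?_ ?_ ?_ ?_ ?_
  · exact Eventually.of_forall fun y ↦
      (hf.continuous.comp (Continuous.prodMk_right y)).aestronglyMeasurable
  · exact (hf.continuous.comp (Continuous.prodMk_right x)).intervalIntegrable _ _
  · exact (hf'.comp (Continuous.prodMk_right x)).aestronglyMeasurable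
  · refine Eventually.of_forall fun t ht y hy ↦ hC ?_
    rw [uIoc_of_le zero_le_one] at ht
    exact ⟨(y, t), ⟨hy, Ioc_subset_Icc_self ht⟩, rfl⟩
  · exact intervalIntegrable_const
  · refine Eventually.of_forall fun t _ y _ ↦ ?_
    have h1 : HasFDerivAt (fun z : E ↦ (z, t)) (ContinuousLinearMap.inl ℝ E ℝ) y :=
      hasFDerivAt_prodMk_left y t
    exact ((hf.differentiable one_ne_zero (y, t)).hasFDerivAt).comp y h1

lemma contDiff_one_intervalIntegral {f : E × ℝ → F} [CompleteSpace F] (hf : ContDiff ℝ 1 f) :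
    ContDiff ℝ 1 (fun y ↦ ∫ t in (0 : ℝ)..1, f (y, t)) := by
  rw [contDiff_one_iff_fderiv]
  refine ⟨fun x ↦ (hasFDerivAt_intervalIntegral hf x).differentiableAt, ?_⟩
  rw [funext fun x ↦ (hasFDerivAt_intervalIntegral hf x).fderiv]
  refine intervalIntegral.continuous_parametric_intervalIntegral_of_continuous' ?_ 0 1
  exact ((hf.continuous_fderiv one_ne_zero).clm_comp continuous_const)

/-- The Poincaré lemma for 2-forms on a ball. -/
theorem exists_primitive_of_closed {S : Set E} (hS : IsOpen S) {η : E → E [⋀^Fin 2]→L[ℝ] ℝ}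
    (hη : ContDiffOn ℝ ∞ η S) (hd : ∀ y ∈ S, extDeriv η y = 0) {a : E} {r R : ℝ}
    (hr : 0 < r) (hrR : r < R) (hR : Metric.closedBall a R ⊆ S) :
    ∃ l : E → E →L[ℝ] ℝ, ContDiff ℝ 1 l ∧ ∀ y ∈ Metric.ball a r, ∀ u v,
      η y ![u, v] = fderiv ℝ l y u v - fderiv ℝ l y v u := by
  -- The cutoff makes the form globally smooth without changing it on the small ball, so parametric
  -- integrals can be differentiated with no domain conditions. The product need not be closed
  -- outside that ball.
  let χ : ContDiffBump a := ⟨r, R, hr, hrR⟩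
  let w : E → E →L[ℝ] E →L[ℝ] ℝ := S.indicator fun y ↦ χ y • bilinOfForm (η y)
  have hb : ContDiffOn ℝ ∞ (fun y ↦ bilinOfForm (η y)) S :=
    contDiff_bilinOfForm.comp_contDiffOn hη
  have hw : ContDiff ℝ ∞ w := by
    refine contDiff_indicator (K := Metric.closedBall a R) hS Metric.isClosed_closedBall hR
      (χ.contDiff.contDiffOn.smul hb) fun y _ hyK ↦ ?_
    have : χ y = 0 := χ.zero_of_le_dist (by simpa using (not_le.1 hyK).le)
    simp [this]
  have hball : Metric.ball a r ⊆ S :=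
    (Metric.ball_subset_closedBall.trans (Metric.closedBall_subset_closedBall hrR.le)).trans hR
  have hwη : ∀ y ∈ Metric.ball a r, w y = bilinOfForm (η y) := fun y hy ↦ by
    have : χ y = 1 := χ.one_of_mem_closedBall (Metric.ball_subset_closedBall hy)
    simp [w, indicator_of_mem (hball hy), this]
  have hdw : ∀ y ∈ Metric.ball a r, ∀ h u v, fderiv ℝ w y h u v = fderiv ℝ η y h ![u, v] := by
    intro y hy h u v
    have h1 : w =ᶠ[𝓝 y] fun z ↦ bilinOfForm (η z) := by
      filter_upwards [Metric.isOpen_ball.mem_nhds hy] with z hz using hwη z hz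
    have h2 : DifferentiableAt ℝ η y :=
      (hη.contDiffAt (hS.mem_nhds (hball hy))).differentiableAt (by simp)
    have h3 : fderiv ℝ w y = bilinOfForm.comp (fderiv ℝ η y) := by
      rw [h1.fderiv_eq]
      exact ((hasFDerivAt_bilinOfForm (η y)).comp y h2.hasFDerivAt).fderiv
    rw [h3]
    simp
  have hclosed : ∀ y ∈ Metric.ball a r, ∀ h u v,
      fderiv ℝ w y h u v - fderiv ℝ w y u h v + fderiv ℝ w y v h u = 0 := by
    intro y hy h u v
    have h2 : DifferentiableAt ℝ η y :=
      (hη.contDiffAt (hS.mem_nhds (hball hy))).differentiableAt (by simp)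
    have h3 := congrArg (fun θ ↦ θ ![h, u, v]) (hd y (hball hy))
    simp only [extDeriv, ContinuousAlternatingMap.alternatizeUncurryFin_apply,
      ] at h3
    erw [Fin.sum_univ_three] at h3
    rw [hdw y hy, hdw y hy, hdw y hy]
    have e0 : Fin.removeNth (0 : Fin 3) ![h, u, v] = ![u, v] := by
      ext i; fin_cases i <;> rfl
    have e1 : Fin.removeNth (1 : Fin 3) ![h, u, v] = ![h, v] := by
      ext i; fin_cases i <;> rfl
    have e2 : Fin.removeNth (2 : Fin 3) ![h, u, v] = ![h, u] := by
      ext i; fin_cases i <;> rfl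
    simp only [e0, e1, e2] at h3
    simp at h3
    linarith
  -- Integrand of the radial homotopy operator: the primitive at `y` is `∫₀¹ t w(a + t(y - a))(y -
  -- a, ·) dt`.
  let f : E × ℝ → E →L[ℝ] ℝ := fun p ↦ p.2 • w (a + p.2 • (p.1 - a)) (p.1 - a)
  have hf : ContDiff ℝ 1 f := by
    have : ContDiff ℝ 1 w := hw.of_le (by simp)
    refine contDiff_snd.smul (ContDiff.clm_apply (this.comp ?_) ?_)
    · exact contDiff_const.add (contDiff_snd.smul (contDiff_fst.sub contDiff_const))
    · exact contDiff_fst.sub contDiff_const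
  refine ⟨fun y ↦ ∫ t in (0 : ℝ)..1, f (y, t), contDiff_one_intervalIntegral hf, ?_⟩
  intro y hy u v
  have hcont : Continuous fun t : ℝ ↦
      (fderiv ℝ f (y, t)).comp (ContinuousLinearMap.inl ℝ E ℝ) :=
    ((hf.continuous_fderiv one_ne_zero).clm_comp continuous_const).comp (Continuous.prodMk_right y)
  have key : ∀ h k, (∫ t in (0 : ℝ)..1,
      (fderiv ℝ f (y, t)).comp (ContinuousLinearMap.inl ℝ E ℝ)) h k =
      ∫ t in (0 : ℝ)..1, fderiv ℝ f (y, t) (h, 0) k := by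
    intro h k
    rw [ContinuousLinearMap.intervalIntegral_apply (hcont.intervalIntegrable 0 1),
      ContinuousLinearMap.intervalIntegral_apply
        ((hcont.clm_apply continuous_const).intervalIntegrable 0 1)]
    rfl
  have hci : ∀ h k, IntervalIntegrable (fun t ↦ fderiv ℝ f (y, t) (h, 0) k) volume 0 1 := by
    intro h k
    refine Continuous.intervalIntegrable ?_ _ _
    exact (hcont.clm_apply (continuous_const (y := h))).clm_apply (continuous_const (y := k))
  rw [(hasFDerivAt_intervalIntegral hf y).fderiv, key, key,
    ← intervalIntegral.integral_sub (hci _ _) (hci _ _)]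
  have hfd : ∀ (t : ℝ) (h k : E), fderiv ℝ f (y, t) (h, 0) k =
      t * (t * fderiv ℝ w (a + t • (y - a)) h (y - a) k + w (a + t • (y - a)) h k) := by
    intro t h k
    have h1 : HasFDerivAt (fun z : E ↦ w (a + t • (z - a)))
        ((fderiv ℝ w (a + t • (y - a))).comp (t • ContinuousLinearMap.id ℝ E)) y := by
      refine (hw.differentiable (by simp) _).hasFDerivAt.comp y ?_
      exact (((hasFDerivAt_id y).sub_const a).const_smul t).const_add a
    have h2 : HasFDerivAt (fun z : E ↦ f (z, t)) _ y :=
      (h1.clm_apply ((hasFDerivAt_id y).sub_const a)).const_smul t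
    have h3 : HasFDerivAt (fun z : E ↦ f (z, t))
        ((fderiv ℝ f (y, t)).comp (ContinuousLinearMap.inl ℝ E ℝ)) y :=
      HasFDerivAt.comp (g := f) y (hf.differentiable one_ne_zero (y, t)).hasFDerivAt
        (hasFDerivAt_prodMk_left y t)
    have h4 := congrArg (fun L ↦ L h k) (h3.unique h2)
    simp only [ContinuousLinearMap.comp_apply, ContinuousLinearMap.inl_apply,
      smul_apply, add_apply, ContinuousLinearMap.flip_apply,
      ContinuousLinearMap.id_apply, id, map_smul, smul_eq_mul] at h4
    rw [h4]
    ring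
  have hmem : ∀ t ∈ Icc (0 : ℝ) 1, a + t • (y - a) ∈ Metric.ball a r := by
    intro t ht
    rw [Metric.mem_ball, dist_eq_norm] at hy ⊢
    rw [add_sub_cancel_left, norm_smul, Real.norm_of_nonneg ht.1]
    nlinarith [norm_nonneg (y - a), ht.2]
  -- Closedness turns the antisymmetrized derivative of the integrand into this `t`-derivative,
  -- whose integral is the value of the form at `y`, since the factor `t ^ 2` kills the endpoint
  -- `0`.
  have hprim : ∀ t : ℝ, HasDerivAt (fun t : ℝ ↦ t ^ 2 * w (a + t • (y - a)) u v)
      (t ^ 2 * fderiv ℝ w (a + t • (y - a)) (y - a) u v + 2 * t * w (a + t • (y - a)) u v) t := by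
    intro t
    have h1 : HasDerivAt (fun t : ℝ ↦ a + t • (y - a)) (y - a) t := by
      simpa using ((hasDerivAt_id t).smul_const (y - a)).const_add a
    have h2 : HasDerivAt (fun t : ℝ ↦ w (a + t • (y - a)))
        (fderiv ℝ w (a + t • (y - a)) (y - a)) t :=
      (hw.differentiable (by simp) _).hasFDerivAt.comp_hasDerivAt t h1
    have h3 : HasDerivAt (fun t : ℝ ↦ w (a + t • (y - a)) u v)
        (fderiv ℝ w (a + t • (y - a)) (y - a) u v) t := by
      have := (h2.clm_apply (hasDerivAt_const t u)).clm_apply (hasDerivAt_const t v)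
      simpa using this
    refine ((hasDerivAt_pow 2 t).mul h3).congr_deriv ?_
    push_cast
    ring
  have hint : ∫ t in (0 : ℝ)..1, (t ^ 2 * fderiv ℝ w (a + t • (y - a)) (y - a) u v +
      2 * t * w (a + t • (y - a)) u v) = η y ![u, v] := by
    rw [intervalIntegral.integral_eq_sub_of_hasDerivAt (fun t _ ↦ hprim t)]
    · simp [hwη y hy]
    · refine Continuous.intervalIntegrable ?_ _ _
      have c1 : Continuous (fderiv ℝ w) := hw.continuous_fderiv (by simp)
      have c2 : Continuous w := hw.continuous
      have c3 : Continuous fun t : ℝ ↦ a + t • (y - a) := by fun_prop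
      have c4 : Continuous fun t : ℝ ↦ fderiv ℝ w (a + t • (y - a)) := c1.comp c3
      have c5 : Continuous fun t : ℝ ↦ w (a + t • (y - a)) := c2.comp c3
      fun_prop
  rw [← hint]
  refine intervalIntegral.integral_congr fun t ht ↦ ?_
  rw [uIcc_of_le zero_le_one] at ht
  have hz := hmem t ht
  have e1 := hclosed _ hz (y - a) u v
  have e2 : w (a + t • (y - a)) v u = -w (a + t • (y - a)) u v := by
    rw [hwη _ hz, bilinOfForm_apply, bilinOfForm_apply, alternating_two_swap]
  simp only [hfd, e2]
  have e3 : fderiv ℝ w (a + t • (y - a)) u (y - a) v =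
    fderiv ℝ w (a + t • (y - a)) (y - a) u v + fderiv ℝ w (a + t • (y - a)) v (y - a) u := by
    linarith
  rw [e3]
  ring

omit [FiniteDimensional ℝ E] in
/-- The exterior derivative of the pullback of a 1-form. -/
lemma fderiv_pullback_antisymm {G : Type*} [NormedAddCommGroup G] [NormedSpace ℝ G]
    {l : G → G →L[ℝ] ℝ} {u : E → G} {y : E} (hl : DifferentiableAt ℝ l (u y))
    (hu : ContDiffAt ℝ 2 u y) (v w : E) :
    fderiv ℝ (fun z ↦ (l (u z)).comp (fderiv ℝ u z)) y v w -
      fderiv ℝ (fun z ↦ (l (u z)).comp (fderiv ℝ u z)) y w v =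
    fderiv ℝ l (u y) (fderiv ℝ u y v) (fderiv ℝ u y w) -
      fderiv ℝ l (u y) (fderiv ℝ u y w) (fderiv ℝ u y v) := by
  have h1 : HasFDerivAt (fun z ↦ l (u z)) ((fderiv ℝ l (u y)).comp (fderiv ℝ u y)) y :=
    hl.hasFDerivAt.comp y (hu.differentiableAt (by simp)).hasFDerivAt
  have h2 : HasFDerivAt (fderiv ℝ u) (fderiv ℝ (fderiv ℝ u) y) y :=
    ((hu.fderiv_right (m := 1) (by norm_num)).differentiableAt one_ne_zero).hasFDerivAt
  have h3 := (h1.clm_comp h2).fderiv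
  -- The terms containing the second derivative of `u` cancel on antisymmetrizing; this is why the
  -- exterior derivative commutes with pullback.
  have hsymm : IsSymmSndFDerivAt ℝ u y := hu.isSymmSndFDerivAt (by simp)
  rw [h3]
  simp [hsymm.eq v w]

end Euclidean

/-! ### Integration by parts against a divergence-free bivector density. -/

section Stokes

/-- The product is continuous on the compact set `tsupport g` and vanishes off it. No control of `f`
outside `S` is needed, which suits coordinate expressions that are meaningful only on a chart
target. -/
lemma integrable_mul_of_tsupport_subset {E : Type*} [NormedAddCommGroup E] [NormedSpace ℝ E]
    [FiniteDimensional ℝ E] [MeasurableSpace E] [BorelSpace E] {μ : Measure E}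
    [IsFiniteMeasureOnCompacts μ] {f g : E → ℝ} {S : Set E} (hf : ContinuousOn f S)
    (hg : Continuous g) (hc : HasCompactSupport g) (hS : tsupport g ⊆ S) :
    Integrable (fun y ↦ f y * g y) μ := by
  have h : IntegrableOn (fun y ↦ f y * g y) (tsupport g) μ :=
    ((hf.mono hS).mul hg.continuousOn).integrableOn_compact hc
  refine (integrableOn_iff_integrable_of_support_subset fun y hy ↦ subset_tsupport g ?_).1 h
  exact right_ne_zero_of_mul hy

variable {m : ℕ}

/-- A divergence-free bivector field is orthogonal to the exterior derivative of every compactly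
supported 1-form. -/
theorem integral_divergenceFree_mul_fderiv_eq_zero {S : Set (EuclideanSpace ℝ (Fin m))}
    (hS : IsOpen S) {a : EuclideanSpace ℝ (Fin m) → Matrix (Fin m) (Fin m) ℝ}
    (ha : ∀ i j, ContDiffOn ℝ 1 (fun y ↦ a y i j) S)
    (hdiv : ∀ y ∈ S, ∀ j, ∑ i, fderiv ℝ (fun z ↦ a z i j) y (EuclideanSpace.single i 1) = 0)
    {β : EuclideanSpace ℝ (Fin m) → EuclideanSpace ℝ (Fin m) →L[ℝ] ℝ} (hβ : ContDiff ℝ 1 β)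
    (hc : HasCompactSupport β) (hs : tsupport β ⊆ S) :
    ∫ y, ∑ i, ∑ j, a y i j *
      fderiv ℝ β y (EuclideanSpace.single i 1) (EuclideanSpace.single j 1) = 0 := by
  let e : Fin m → EuclideanSpace ℝ (Fin m) := fun i ↦ EuclideanSpace.single i 1
  let b : Fin m → EuclideanSpace ℝ (Fin m) → ℝ := fun j y ↦ β y (e j)
  have hb : ∀ j, ContDiff ℝ 1 (b j) := fun j ↦ hβ.clm_apply contDiff_const
  have hbc : ∀ j, HasCompactSupport (b j) := fun j ↦
    hc.comp_left (g := fun L : EuclideanSpace ℝ (Fin m) →L[ℝ] ℝ ↦ L (e j)) rfl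
  have hbs : ∀ j, tsupport (b j) ⊆ S := fun j ↦
    (closure_mono (Function.support_comp_subset
      (g := fun L : EuclideanSpace ℝ (Fin m) →L[ℝ] ℝ ↦ L (e j)) rfl β)).trans hs
  have hdb : ∀ i j y, fderiv ℝ β y (e i) (e j) = fderiv ℝ (b j) y (e i) := by
    intro i j y
    have h := ((hβ.differentiable one_ne_zero y).hasFDerivAt.clm_apply
      (hasFDerivAt_const (e j) y)).fderiv
    simp only [b]
    rw [h]
    simp
  have hdbc : ∀ i j, Continuous fun y ↦ fderiv ℝ (b j) y (e i) := fun i j ↦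
    ((hb j).continuous_fderiv one_ne_zero).clm_apply continuous_const
  have hdbS : ∀ i j, tsupport (fun y ↦ fderiv ℝ (b j) y (e i)) ⊆ tsupport (b j) := fun i j ↦
    tsupport_fderiv_apply_subset ℝ (e i)
  have hdbC : ∀ i j, HasCompactSupport fun y ↦ fderiv ℝ (b j) y (e i) := fun i j ↦
    (hbc j).fderiv_apply (𝕜 := ℝ) (e i)
  have hda : ∀ i j, ContinuousOn (fun y ↦ fderiv ℝ (fun z ↦ a z i j) y (e i)) S := fun i j ↦
    ((ha i j).continuousOn_fderiv_of_isOpen hS le_rfl).clm_apply continuousOn_const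
  have int1 : ∀ i j, Integrable fun y ↦ a y i j * fderiv ℝ (b j) y (e i) := fun i j ↦
    integrable_mul_of_tsupport_subset (ha i j).continuousOn (hdbc i j) (hdbC i j)
      ((hdbS i j).trans (hbs j))
  have int2 : ∀ i j, Integrable fun y ↦ fderiv ℝ (fun z ↦ a z i j) y (e i) * b j y := fun i j ↦
    integrable_mul_of_tsupport_subset (hda i j) (hb j).continuous (hbc j) (hbs j)
  have int3 : ∀ i j, Integrable fun y ↦ a y i j * b j y := fun i j ↦
    integrable_mul_of_tsupport_subset (ha i j).continuousOn (hb j).continuous (hbc j) (hbs j)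
  -- There is no boundary term because `b j` has compact support in `S`. Summing over `i` afterwards
  -- produces the divergence of column `j`.
  have parts : ∀ i j, ∫ y, a y i j * fderiv ℝ (b j) y (e i) =
      -∫ y, fderiv ℝ (fun z ↦ a z i j) y (e i) * b j y := fun i j ↦
    integral_mul_fderiv_eq_neg_fderiv_mul_of_integrable (int2 i j) (int1 i j) (int3 i j)
      (fun y hy ↦ ((ha i j).contDiffAt (hS.mem_nhds (hbs j hy))).differentiableAt one_ne_zero)
      (fun y _ ↦ (hb j).differentiable one_ne_zero y)
  calc ∫ y, ∑ i, ∑ j, a y i j * fderiv ℝ β y (e i) (e j)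
      = ∫ y, ∑ i, ∑ j, a y i j * fderiv ℝ (b j) y (e i) := by simp only [hdb]
    _ = ∑ i, ∑ j, ∫ y, a y i j * fderiv ℝ (b j) y (e i) := by
        rw [integral_finsetSum _ fun i _ ↦ integrable_finsetSum _ fun j _ ↦ int1 i j]
        exact Finset.sum_congr rfl fun i _ ↦ integral_finsetSum _ fun j _ ↦ int1 i j
    _ = -∑ j, ∑ i, ∫ y, fderiv ℝ (fun z ↦ a z i j) y (e i) * b j y := by
        simp only [parts, Finset.sum_neg_distrib]
        rw [Finset.sum_comm]
    _ = -∑ j, ∫ y, (∑ i, fderiv ℝ (fun z ↦ a z i j) y (e i)) * b j y := by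
        congr 1
        refine Finset.sum_congr rfl fun j _ ↦ ?_
        simp only [Finset.sum_mul]
        rw [integral_finsetSum _ fun i _ ↦ int2 i j]
    _ = 0 := by
        rw [neg_eq_zero]
        refine Finset.sum_eq_zero fun j _ ↦ ?_
        rw [← integral_zero (EuclideanSpace ℝ (Fin m)) ℝ (μ := volume)]
        congr 1
        ext y
        by_cases hy : y ∈ S
        · rw [hdiv y hy j, zero_mul]
        · rw [image_eq_zero_of_notMem_tsupport fun h ↦ hy (hbs j h), mul_zero]

end Stokes

/-! ### Matrices of bilinear forms and of endomorphisms, and smoothness of matrix operations. -/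

section FrameMatrix

variable {m : ℕ}

/-- The matrix of a bilinear form in the standard basis of `ℝᵐ`. -/
def frameMatrix (B : EuclideanSpace ℝ (Fin m) →L[ℝ] EuclideanSpace ℝ (Fin m) →L[ℝ] ℝ) :
    Matrix (Fin m) (Fin m) ℝ :=
  Matrix.of fun i j ↦ B (EuclideanSpace.single i 1) (EuclideanSpace.single j 1)

/-- The matrix of an endomorphism in the standard basis of `ℝᵐ`. -/
def clmMatrix (L : EuclideanSpace ℝ (Fin m) →L[ℝ] EuclideanSpace ℝ (Fin m)) :
    Matrix (Fin m) (Fin m) ℝ :=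
  LinearMap.toMatrix (EuclideanSpace.basisFun (Fin m) ℝ).toBasis
    (EuclideanSpace.basisFun (Fin m) ℝ).toBasis (L : _ →ₗ[ℝ] _)

lemma det_clmMatrix (L : EuclideanSpace ℝ (Fin m) →L[ℝ] EuclideanSpace ℝ (Fin m)) :
    (clmMatrix L).det = L.det :=
  LinearMap.det_toMatrix _ _

lemma det_clm_comp (L K : EuclideanSpace ℝ (Fin m) →L[ℝ] EuclideanSpace ℝ (Fin m)) :
    (L.comp K).det = L.det * K.det :=
  LinearMap.det_comp _ _

lemma frameMatrix_eq_toMatrix₂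
    (B : EuclideanSpace ℝ (Fin m) →L[ℝ] EuclideanSpace ℝ (Fin m) →L[ℝ] ℝ) :
    frameMatrix B = LinearMap.toMatrix₂ (EuclideanSpace.basisFun (Fin m) ℝ).toBasis
      (EuclideanSpace.basisFun (Fin m) ℝ).toBasis
      (ContinuousLinearMap.toLinearMap₁₂ B) := by
  ext i j
  simp [frameMatrix, LinearMap.toMatrix₂_apply]

/-- Transformation of the matrix of a bilinear form under a change of frame. -/
lemma frameMatrix_bilinearComp
    (B : EuclideanSpace ℝ (Fin m) →L[ℝ] EuclideanSpace ℝ (Fin m) →L[ℝ] ℝ)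
    (L : EuclideanSpace ℝ (Fin m) →L[ℝ] EuclideanSpace ℝ (Fin m)) :
    frameMatrix (B.bilinearComp L L) = (clmMatrix L).transpose * frameMatrix B * clmMatrix L := by
  rw [frameMatrix_eq_toMatrix₂ B, clmMatrix, ← LinearMap.toMatrix₂_compl₁₂,
    frameMatrix_eq_toMatrix₂]
  rfl

lemma posDef_frameMatrix {B : EuclideanSpace ℝ (Fin m) →L[ℝ] EuclideanSpace ℝ (Fin m) →L[ℝ] ℝ}
    (hs : ∀ v w, B v w = B w v) (hp : ∀ v, v ≠ 0 → 0 < B v v) : (frameMatrix B).PosDef := by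
  refine Matrix.PosDef.of_dotProduct_mulVec_pos ?_ fun x hx ↦ ?_
  · ext i j
    simp [frameMatrix, hs]
  · have h := hp (∑ i, x i • EuclideanSpace.single i 1) fun h ↦ hx <| by
      ext i
      have := congrArg (fun v : EuclideanSpace ℝ (Fin m) ↦ v i) h
      simpa [Pi.single_apply] using this
    simp only [map_sum, map_smul, sum_apply, smul_apply, smul_eq_mul] at h
    simp only [Matrix.mulVec, dotProduct, frameMatrix, Matrix.of_apply, star_trivial]
    refine h.trans_eq (Finset.sum_congr rfl fun i _ ↦ congrArg (x i * ·)
      (Finset.sum_congr rfl fun j _ ↦ ?_))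
    rw [hs, mul_comm]

lemma contDiffOn_det {E ι : Type*} [NormedAddCommGroup E] [NormedSpace ℝ E] [Fintype ι]
    [DecidableEq ι] {n : WithTop ℕ∞} {A : E → Matrix ι ι ℝ} {S : Set E}
    (h : ∀ i j, ContDiffOn ℝ n (fun y ↦ A y i j) S) : ContDiffOn ℝ n (fun y ↦ (A y).det) S := by
  simp only [Matrix.det_apply]
  exact ContDiffOn.sum fun σ _ ↦ (contDiffOn_prod fun i _ ↦ h _ _).const_smul _

/-- Cramer's rule: each entry of the inverse is a determinant, of the matrix with one row replaced
by a constant one, divided by the determinant. -/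
lemma contDiffOn_matrix_inv {E ι : Type*} [NormedAddCommGroup E] [NormedSpace ℝ E] [Fintype ι]
    [DecidableEq ι] {n : WithTop ℕ∞} {A : E → Matrix ι ι ℝ} {S : Set E}
    (h : ∀ i j, ContDiffOn ℝ n (fun y ↦ A y i j) S) (hd : ∀ y ∈ S, (A y).det ≠ 0) (i j : ι) :
    ContDiffOn ℝ n (fun y ↦ (A y)⁻¹ i j) S := by
  simp only [Matrix.inv_def, Matrix.smul_apply, Ring.inverse_eq_inv', smul_eq_mul,
    Matrix.adjugate_apply]
  refine ((contDiffOn_det h).inv hd).mul (contDiffOn_det fun k l ↦ ?_)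
  by_cases hk : k = j
  · subst hk
    simpa using contDiffOn_const
  · simpa [Matrix.updateRow_ne hk] using h k l

end FrameMatrix

/-! ### Differentials of charts, and maps and pullbacks in coordinates. -/

section Charts

variable {m : ℕ} {M : Type*} [TopologicalSpace M] [ChartedSpace (EuclideanSpace ℝ (Fin m)) M]
  [IsManifold (𝓡 m) ∞ M]

lemma contMDiffAt_chart {c x : M} (hx : x ∈ (chartAt (EuclideanSpace ℝ (Fin m)) c).source) :
    ContMDiffAt (𝓡 m) (𝓡 m) ∞ (chartAt (EuclideanSpace ℝ (Fin m)) c) x :=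
  contMDiffOn_chart.contMDiffAt ((chartAt _ c).open_source.mem_nhds hx)

lemma contMDiffAt_chart_symm {c : M} {y : EuclideanSpace ℝ (Fin m)}
    (hy : y ∈ (chartAt (EuclideanSpace ℝ (Fin m)) c).target) :
    ContMDiffAt (𝓡 m) (𝓡 m) ∞ (chartAt (EuclideanSpace ℝ (Fin m)) c).symm y :=
  contMDiffOn_chart_symm.contMDiffAt ((chartAt _ c).open_target.mem_nhds hy)

/-- `chartInvDeriv` as an endomorphism of `ℝᵐ`. -/
def chartInvEndo (c : M) (y : EuclideanSpace ℝ (Fin m)) :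
    EuclideanSpace ℝ (Fin m) →L[ℝ] EuclideanSpace ℝ (Fin m) :=
  chartInvDeriv c y

/-- The differential of a chart as an endomorphism of `ℝᵐ`. -/
def chartEndo (c x : M) : EuclideanSpace ℝ (Fin m) →L[ℝ] EuclideanSpace ℝ (Fin m) :=
  mfderiv (𝓡 m) (𝓡 m) (chartAt (EuclideanSpace ℝ (Fin m)) c) x

lemma chartInvEndo_comp_chartEndo {c x : M}
    (hx : x ∈ (chartAt (EuclideanSpace ℝ (Fin m)) c).source) :
    (chartInvEndo c (chartAt (EuclideanSpace ℝ (Fin m)) c x)).comp (chartEndo c x) =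
      ContinuousLinearMap.id ℝ _ :=
  (mdifferentiable_chart (I := 𝓡 m) c).symm_comp_deriv hx

lemma chartEndo_comp_chartInvEndo {c : M} {y : EuclideanSpace ℝ (Fin m)}
    (hy : y ∈ (chartAt (EuclideanSpace ℝ (Fin m)) c).target) :
    (chartEndo c ((chartAt (EuclideanSpace ℝ (Fin m)) c).symm y)).comp (chartInvEndo c y) =
      ContinuousLinearMap.id ℝ _ :=
  (mdifferentiable_chart (I := 𝓡 m) c).comp_symm_deriv hy

lemma det_chartInvEndo_ne_zero {c : M} {y : EuclideanSpace ℝ (Fin m)}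
    (hy : y ∈ (chartAt (EuclideanSpace ℝ (Fin m)) c).target) :
    (chartInvEndo c y).det ≠ 0 := by
  intro h
  have h1 := congrArg (fun L ↦ L.det) (chartEndo_comp_chartInvEndo hy)
  simp only [det_clm_comp, h, mul_zero] at h1
  simp [ContinuousLinearMap.det] at h1

/-- A form at a point of a chart domain, in terms of its expression in the chart. -/
lemma form_apply_eq_inChart {k : ℕ} (α : DiffForm m M k) {p q : M}
    (hq : q ∈ (chartAt (EuclideanSpace ℝ (Fin m)) p).source)
    (v : Fin k → EuclideanSpace ℝ (Fin m)) :
    α q v = α.inChart p (chartAt (EuclideanSpace ℝ (Fin m)) p q) (fun i ↦ chartEndo p q (v i)) := by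
  have h1 : ∀ i, chartInvEndo p (chartAt (EuclideanSpace ℝ (Fin m)) p q) (chartEndo p q (v i)) =
      v i := fun i ↦ congrArg (fun L ↦ L (v i)) (chartInvEndo_comp_chartEndo hq)
  -- Identifying every tangent space with `ℝᵐ` removes the dependence of the type on the base point,
  -- so that the base point can be rewritten.
  let a : M → (Fin k → EuclideanSpace ℝ (Fin m)) → ℝ := fun x w ↦ α x w
  have h2 : α.inChart p (chartAt (EuclideanSpace ℝ (Fin m)) p q) (fun i ↦ chartEndo p q (v i)) =
      a ((chartAt (EuclideanSpace ℝ (Fin m)) p).symm (chartAt (EuclideanSpace ℝ (Fin m)) p q))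
        (fun i ↦ chartInvEndo p (chartAt (EuclideanSpace ℝ (Fin m)) p q) (chartEndo p q (v i))) :=
    rfl
  rw [h2, (chartAt (EuclideanSpace ℝ (Fin m)) p).left_inv hq]
  simp only [h1]
  rfl

variable {n : ℕ} {N : Type*} [TopologicalSpace N] [ChartedSpace (EuclideanSpace ℝ (Fin n)) N]
  [IsManifold (𝓡 n) ∞ N]

/-- The expression of a map in charts. -/
def mapInCharts (c : M) (p : N) (φ : M → N) (y : EuclideanSpace ℝ (Fin m)) :
    EuclideanSpace ℝ (Fin n) :=
  chartAt (EuclideanSpace ℝ (Fin n)) p (φ ((chartAt (EuclideanSpace ℝ (Fin m)) c).symm y))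

lemma contDiffAt_mapInCharts {c : M} {p : N} {φ : M → N} {y : EuclideanSpace ℝ (Fin m)}
    (hy : y ∈ (chartAt (EuclideanSpace ℝ (Fin m)) c).target)
    (hφ : ContMDiffAt (𝓡 m) (𝓡 n) ∞ φ ((chartAt (EuclideanSpace ℝ (Fin m)) c).symm y))
    (hp : φ ((chartAt (EuclideanSpace ℝ (Fin m)) c).symm y) ∈
      (chartAt (EuclideanSpace ℝ (Fin n)) p).source) :
    ContDiffAt ℝ ∞ (mapInCharts (n := n) c p φ) y := by
  rw [← contMDiffAt_iff_contDiffAt]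
  exact ((contMDiffAt_chart hp).comp _ hφ).comp y (contMDiffAt_chart_symm hy)

lemma fderiv_mapInCharts {c : M} {p : N} {φ : M → N} {y : EuclideanSpace ℝ (Fin m)}
    (hy : y ∈ (chartAt (EuclideanSpace ℝ (Fin m)) c).target)
    (hφ : MDifferentiableAt (𝓡 m) (𝓡 n) φ ((chartAt (EuclideanSpace ℝ (Fin m)) c).symm y))
    (hp : φ ((chartAt (EuclideanSpace ℝ (Fin m)) c).symm y) ∈
      (chartAt (EuclideanSpace ℝ (Fin n)) p).source) (v : EuclideanSpace ℝ (Fin m)) :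
    fderiv ℝ (mapInCharts (n := n) c p φ) y v =
      chartEndo p (φ ((chartAt (EuclideanSpace ℝ (Fin m)) c).symm y))
        (mfderiv (𝓡 m) (𝓡 n) φ ((chartAt (EuclideanSpace ℝ (Fin m)) c).symm y)
          (chartInvDeriv c y v)) := by
  have h1 := (contMDiffAt_chart (m := n) hp).mdifferentiableAt (by simp)
  have h2 := (contMDiffAt_chart_symm hy).mdifferentiableAt (by simp)
  have h3 : mfderiv (𝓡 m) (𝓡 n) ((chartAt (EuclideanSpace ℝ (Fin n)) p ∘ φ) ∘
      (chartAt (EuclideanSpace ℝ (Fin m)) c).symm) y = _ :=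
    mfderiv_comp y (h1.comp _ hφ) h2
  rw [mfderiv_comp _ h1 hφ] at h3
  rw [← mfderiv_eq_fderiv]
  exact congrArg (fun L ↦ L v) h3

/-- The expression of a pullback in charts. -/
theorem pullback_inChart_apply {k : ℕ} (α : DiffForm n N k) {c : M} {p : N} {φ : M → N}
    {y : EuclideanSpace ℝ (Fin m)} (hy : y ∈ (chartAt (EuclideanSpace ℝ (Fin m)) c).target)
    (hφ : MDifferentiableAt (𝓡 m) (𝓡 n) φ ((chartAt (EuclideanSpace ℝ (Fin m)) c).symm y))
    (hp : φ ((chartAt (EuclideanSpace ℝ (Fin m)) c).symm y) ∈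
      (chartAt (EuclideanSpace ℝ (Fin n)) p).source) (v : Fin k → EuclideanSpace ℝ (Fin m)) :
    (α.pullback φ).inChart c y v =
      α.inChart p (mapInCharts (n := n) c p φ y) (fun i ↦ fderiv ℝ (mapInCharts (n := n) c p φ) y (v i)) := by
  simp only [fderiv_mapInCharts hy hφ hp]
  exact form_apply_eq_inChart α hp _

/-- Change of charts for the inverse chart differentials. -/
lemma chartInvEndo_eq_comp {c c' : M} {y : EuclideanSpace ℝ (Fin m)}
    (hy : y ∈ (chartAt (EuclideanSpace ℝ (Fin m)) c).target)
    (hc' : (chartAt (EuclideanSpace ℝ (Fin m)) c).symm y ∈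
      (chartAt (EuclideanSpace ℝ (Fin m)) c').source) :
    chartInvEndo c y = (chartInvEndo c' (mapInCharts (n := m) c c' id y)).comp
      (fderiv ℝ (mapInCharts (n := m) c c' (id : M → M)) y) := by
  ext1 v
  have h := fderiv_mapInCharts (φ := (id : M → M)) hy mdifferentiableAt_id hc' v
  rw [ContinuousLinearMap.comp_apply, h, mfderiv_id]
  exact (congrArg (fun L ↦ L (chartInvEndo c y v)) (chartInvEndo_comp_chartEndo hc')).symm

end Charts

/-! ### The metric and its volume density in coordinates. -/

section Metric

variable {m : ℕ} {M : Type*} [TopologicalSpace M] [ChartedSpace (EuclideanSpace ℝ (Fin m)) M]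
  [IsManifold (𝓡 m) ∞ M] (g : RiemannianMetric m M)

/-- The metric at a point as a bilinear form on `ℝᵐ`. -/
def metricBilin (x : M) : EuclideanSpace ℝ (Fin m) →L[ℝ] EuclideanSpace ℝ (Fin m) →L[ℝ] ℝ :=
  g.inner x

/-- The Gram matrix of the metric in the preferred frame. -/
lemma gram_tangentFrame (x : M) : gram g x (tangentFrame x) = frameMatrix (metricBilin g x) := rfl

/-- Change of frame between the coordinate frame of a fixed chart, in which the coderivative is
computed, and the pointwise frame used by `normSq`. -/
lemma metricCoord_eq (c : M) (y : EuclideanSpace ℝ (Fin m)) :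
    metricCoord g c y = (clmMatrix (chartInvEndo c y)).transpose *
      gram g ((chartAt (EuclideanSpace ℝ (Fin m)) c).symm y) (tangentFrame _) *
        clmMatrix (chartInvEndo c y) := by
  rw [gram_tangentFrame, ← frameMatrix_bilinearComp]
  rfl

lemma posDef_gram (x : M) : (gram g x (tangentFrame x)).PosDef :=
  posDef_frameMatrix (B := metricBilin g x) (g.symm x) (g.pos x)

lemma det_metricCoord (c : M) (y : EuclideanSpace ℝ (Fin m)) :
    (metricCoord g c y).det = (chartInvEndo c y).det ^ 2 *
      (gram g ((chartAt (EuclideanSpace ℝ (Fin m)) c).symm y) (tangentFrame _)).det := by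
  rw [metricCoord_eq, Matrix.det_mul, Matrix.det_mul, Matrix.det_transpose, det_clmMatrix]
  ring

lemma det_metricCoord_pos {c : M} {y : EuclideanSpace ℝ (Fin m)}
    (hy : y ∈ (chartAt (EuclideanSpace ℝ (Fin m)) c).target) : 0 < (metricCoord g c y).det := by
  rw [det_metricCoord]
  have := det_chartInvEndo_ne_zero hy
  have := (posDef_gram g ((chartAt (EuclideanSpace ℝ (Fin m)) c).symm y)).det_pos
  positivity

lemma volDensity_pos {c : M} {y : EuclideanSpace ℝ (Fin m)}
    (hy : y ∈ (chartAt (EuclideanSpace ℝ (Fin m)) c).target) : 0 < volDensity g c y :=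
  Real.sqrt_pos.2 (det_metricCoord_pos g hy)

lemma volDensity_eq (c : M) (y : EuclideanSpace ℝ (Fin m)) :
    volDensity g c y = |(chartInvEndo c y).det| *
      √ (gram g ((chartAt (EuclideanSpace ℝ (Fin m)) c).symm y) (tangentFrame _)).det := by
  rw [volDensity, det_metricCoord, Real.sqrt_mul (sq_nonneg _), Real.sqrt_sq_eq_abs]

/-- Change of charts for the volume density. -/
lemma volDensity_change {c c' : M} {y : EuclideanSpace ℝ (Fin m)}
    (hy : y ∈ (chartAt (EuclideanSpace ℝ (Fin m)) c).target)
    (hc' : (chartAt (EuclideanSpace ℝ (Fin m)) c).symm y ∈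
      (chartAt (EuclideanSpace ℝ (Fin m)) c').source) :
    volDensity g c y = |(fderiv ℝ (mapInCharts (n := m) c c' (id : M → M)) y).det| *
      volDensity g c' (mapInCharts (n := m) c c' (id : M → M) y) := by
  have h : (chartAt (EuclideanSpace ℝ (Fin m)) c').symm (mapInCharts (n := m) c c' (id : M → M) y) =
      (chartAt (EuclideanSpace ℝ (Fin m)) c).symm y :=
    (chartAt (EuclideanSpace ℝ (Fin m)) c').left_inv hc'
  rw [volDensity_eq, volDensity_eq, h, chartInvEndo_eq_comp hy hc']
  rw [det_clm_comp, abs_mul]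
  ring

/-- Coordinate vector fields are smooth sections: they are the tangent map of the inverse chart
applied to the constant section `v`. -/
lemma contMDiffOn_chartInvDeriv_apply (c : M) (v : EuclideanSpace ℝ (Fin m)) :
    ContMDiffOn (𝓡 m) (𝓡 m).tangent ∞
      (fun y ↦ (⟨(chartAt (EuclideanSpace ℝ (Fin m)) c).symm y, chartInvDeriv c y v⟩ :
        TangentBundle (𝓡 m) M)) (chartAt (EuclideanSpace ℝ (Fin m)) c).target := by
  have ho := (chartAt (EuclideanSpace ℝ (Fin m)) c).open_target
  have h1 : ContMDiffOn (𝓡 m).tangent (𝓡 m).tangent ∞ _ _ :=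
    (contMDiffOn_chart_symm (I := 𝓡 m) (n := ∞) (x := c)).contMDiffOn_tangentMapWithin
    (m := ∞) (by simp) ho.uniqueMDiffOn
  have h2 : ContMDiff (𝓡 m) (𝓡 m).tangent ∞
      (fun y ↦ (⟨y, v⟩ : TangentBundle (𝓡 m) (EuclideanSpace ℝ (Fin m)))) := fun y ↦
    contMDiffAt_vectorSpace_iff_contDiffAt.2 contDiffAt_const
  refine (h1.comp h2.contMDiffOn (fun y hy ↦ hy)).congr fun y hy ↦ ?_
  simp only [Function.comp, tangentMapWithin]
  rw [mfderivWithin_of_isOpen ho hy]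
  rfl

lemma contDiffOn_metricCoord (c : M) (i j : Fin m) :
    ContDiffOn ℝ ∞ (fun y ↦ metricCoord g c y i j)
      (chartAt (EuclideanSpace ℝ (Fin m)) c).target := by
  rw [← contMDiffOn_iff_contDiffOn]
  intro y hy
  have hb := (contMDiffOn_chart_symm (I := 𝓡 m) (n := ∞) (x := c)) y hy
  -- The metric is smooth only as a section of a bundle of bilinear forms, so it is paired with the
  -- coordinate fields as sections; the scalar function is then the fibre component in the trivial
  -- line bundle.
  have : ContMDiffWithinAt (𝓡 m) ((𝓡 m).prod 𝓘(ℝ)) ∞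
      (fun z ↦ Bundle.TotalSpace.mk' ℝ (E := Bundle.Trivial M ℝ)
        ((chartAt (EuclideanSpace ℝ (Fin m)) c).symm z)
        (g.inner _ (coordFrame c z i) (coordFrame c z j)))
        (chartAt (EuclideanSpace ℝ (Fin m)) c).target y := by
    apply ContMDiffWithinAt.clm_bundle_apply₂ (F₁ := EuclideanSpace ℝ (Fin m))
      (F₂ := EuclideanSpace ℝ (Fin m))
    · exact ContMDiffAt.comp_contMDiffWithinAt y g.contMDiff.contMDiffAt hb
    · exact contMDiffOn_chartInvDeriv_apply c _ y hy
    · exact contMDiffOn_chartInvDeriv_apply c _ y hy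
  simp only [Bundle.contMDiffWithinAt_totalSpace] at this
  exact this.2

lemma contDiffOn_volDensity (c : M) :
    ContDiffOn ℝ ∞ (volDensity g c) (chartAt (EuclideanSpace ℝ (Fin m)) c).target :=
  (contDiffOn_det (contDiffOn_metricCoord g c)).sqrt fun _ hy ↦ (det_metricCoord_pos g hy).ne'

end Metric

/-! ### Linear algebra of the inner product of 2-forms. -/

section Pairing

variable {m : ℕ}

/-- The inner product of the 2-forms with matrices `A` and `B` for the metric with matrix `G`. -/
def matPairing (G A B : Matrix (Fin m) (Fin m) ℝ) : ℝ :=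
  (1 / 2) * ∑ i, ∑ j, A i j * raise G B i j

/-- In trace form, symmetry, positivity and frame independence all follow from cyclicity of the
trace. -/
lemma matPairing_eq_trace (G A B : Matrix (Fin m) (Fin m) ℝ) :
    matPairing G A B = (1 / 2) * (A.transpose * (G⁻¹ * B * G⁻¹)).trace := by
  simp only [matPairing, raise, Matrix.trace, Matrix.diag_apply, Matrix.mul_apply (M := A.transpose),
    Matrix.transpose_apply]
  rw [Finset.sum_comm]

lemma matPairing_sub_left (G A B C : Matrix (Fin m) (Fin m) ℝ) :
    matPairing G (A - B) C = matPairing G A C - matPairing G B C := by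
  simp only [matPairing_eq_trace, Matrix.transpose_sub, Matrix.sub_mul, Matrix.trace_sub]
  ring

lemma matPairing_sub_right (G A B C : Matrix (Fin m) (Fin m) ℝ) :
    matPairing G A (B - C) = matPairing G A B - matPairing G A C := by
  simp only [matPairing_eq_trace, Matrix.mul_sub, Matrix.sub_mul, Matrix.trace_sub]
  ring

lemma matPairing_comm {G : Matrix (Fin m) (Fin m) ℝ} (hG : G.PosDef)
    (A B : Matrix (Fin m) (Fin m) ℝ) : matPairing G A B = matPairing G B A := by
  have hG' : G⁻¹.transpose = G⁻¹ := by
    have := hG.isHermitian.inv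
    simpa [Matrix.IsHermitian] using this
  rw [matPairing_eq_trace, matPairing_eq_trace, ← Matrix.trace_transpose]
  simp only [Matrix.transpose_mul, Matrix.transpose_transpose, hG']
  rw [Matrix.mul_assoc, Matrix.trace_mul_comm]
  simp only [Matrix.mul_assoc]

-- Writing `G⁻¹ = Sᴴ * S`, the pairing becomes half the trace of `Xᴴ * X` with `X = S * A * Sᴴ`,
-- that is, half a squared Frobenius norm.
open scoped MatrixOrder Matrix.Norms.L2Operator in
lemma matPairing_self_nonneg {G : Matrix (Fin m) (Fin m) ℝ} (hG : G.PosDef)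
    (A : Matrix (Fin m) (Fin m) ℝ) : 0 ≤ matPairing G A A := by
  obtain ⟨S, hS⟩ : ∃ S : Matrix (Fin m) (Fin m) ℝ, G⁻¹ = S.conjTranspose * S :=
    CStarAlgebra.nonneg_iff_eq_star_mul_self.1 hG.inv.posSemidef.nonneg
  have h := (Matrix.posSemidef_conjTranspose_mul_self (S * A * S.conjTranspose)).trace_nonneg
  rw [matPairing_eq_trace, hS]
  have e : (A.transpose * (S.conjTranspose * S * A * (S.conjTranspose * S))).trace =
      ((S * A * S.conjTranspose).conjTranspose * (S * A * S.conjTranspose)).trace := by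
    simp only [Matrix.conjTranspose_eq_transpose_of_trivial, Matrix.transpose_mul,
      Matrix.transpose_transpose]
    rw [← Matrix.mul_assoc, ← Matrix.mul_assoc, Matrix.trace_mul_comm]
    simp only [Matrix.mul_assoc]
  rw [e]
  positivity

/-- The inner product of 2-forms does not depend on the frame. -/
lemma matPairing_conj {P : Matrix (Fin m) (Fin m) ℝ} (hP : IsUnit P.det)
    (G A B : Matrix (Fin m) (Fin m) ℝ) :
    matPairing (P.transpose * G * P) (P.transpose * A * P) (P.transpose * B * P) =
      matPairing G A B := by
  have h1 : P * P⁻¹ = 1 := Matrix.mul_nonsing_inv P hP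
  have h2 : P.transpose⁻¹ * P.transpose = 1 :=
    Matrix.nonsing_inv_mul _ (by rwa [Matrix.det_transpose])
  have h3 : (P.transpose * G * P)⁻¹ * (P.transpose * B * P) * (P.transpose * G * P)⁻¹ =
      P⁻¹ * (G⁻¹ * B * G⁻¹) * P.transpose⁻¹ := by
    rw [Matrix.mul_inv_rev, Matrix.mul_inv_rev]
    calc P⁻¹ * (G⁻¹ * P.transpose⁻¹) * (P.transpose * B * P) * (P⁻¹ * (G⁻¹ * P.transpose⁻¹))
        = P⁻¹ * G⁻¹ * (P.transpose⁻¹ * P.transpose) * B * (P * P⁻¹) * G⁻¹ * P.transpose⁻¹ := by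
          simp only [Matrix.mul_assoc]
      _ = _ := by rw [h1, h2]; simp only [Matrix.mul_assoc, Matrix.mul_one]
  rw [matPairing_eq_trace, matPairing_eq_trace, h3]
  congr 1
  calc ((P.transpose * A * P).transpose * (P⁻¹ * (G⁻¹ * B * G⁻¹) * P.transpose⁻¹)).trace
      = (P.transpose * A.transpose * (P * P⁻¹) * (G⁻¹ * B * G⁻¹) * P.transpose⁻¹).trace := by
        simp only [Matrix.transpose_mul, Matrix.transpose_transpose, Matrix.mul_assoc]
    _ = (P.transpose⁻¹ * P.transpose * A.transpose * (G⁻¹ * B * G⁻¹)).trace := by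
        rw [h1, Matrix.trace_mul_comm]
        simp only [Matrix.mul_assoc, Matrix.one_mul]
    _ = _ := by rw [h2, Matrix.one_mul]

end Pairing

/-! ### Pointwise inner product of 2-forms: coordinates, regularity and the basic inequality. -/

section Forms

variable {m : ℕ} {M : Type*} [TopologicalSpace M] [ChartedSpace (EuclideanSpace ℝ (Fin m)) M]

/-- A 2-form at a point as a bilinear form on `ℝᵐ`. -/
def formBilin (α : DiffForm m M 2) (x : M) :
    EuclideanSpace ℝ (Fin m) →L[ℝ] EuclideanSpace ℝ (Fin m) →L[ℝ] ℝ :=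
  bilinOfForm (E := EuclideanSpace ℝ (Fin m)) (α x)

lemma components_tangentFrame (α : DiffForm m M 2) (x : M) :
    α.components x (tangentFrame x) = frameMatrix (formBilin α x) := by
  ext i j
  exact (bilinOfForm_apply (E := EuclideanSpace ℝ (Fin m)) (α x) _ _).symm

/-- The components of a 2-form in the chart at `c`. -/
def formCoord (α : DiffForm m M 2) (c : M) (y : EuclideanSpace ℝ (Fin m)) :
    Matrix (Fin m) (Fin m) ℝ :=
  α.components ((chartAt (EuclideanSpace ℝ (Fin m)) c).symm y) (coordFrame c y)

lemma formCoord_apply (α : DiffForm m M 2) (c : M) (y : EuclideanSpace ℝ (Fin m)) (i j : Fin m) :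
    formCoord α c y i j =
      α.inChart c y ![EuclideanSpace.single i 1, EuclideanSpace.single j 1] := by
  simp only [formCoord, DiffForm.components, Matrix.of_apply, DiffForm.inChart,
    ContinuousAlternatingMap.compContinuousLinearMap_apply]
  congr 1
  ext k
  fin_cases k <;> rfl

variable [IsManifold (𝓡 m) ∞ M] (g : RiemannianMetric m M)

omit [IsManifold (𝓡 m) ∞ M] in
lemma formCoord_eq (α : DiffForm m M 2) (c : M) (y : EuclideanSpace ℝ (Fin m)) :
    formCoord α c y = (clmMatrix (chartInvEndo c y)).transpose *
      α.components ((chartAt (EuclideanSpace ℝ (Fin m)) c).symm y) (tangentFrame _) *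
        clmMatrix (chartInvEndo c y) := by
  rw [components_tangentFrame, ← frameMatrix_bilinearComp]
  ext i j
  exact (bilinOfForm_apply (E := EuclideanSpace ℝ (Fin m)) (α _) _ _).symm

/-- The pointwise inner product of two 2-forms. -/
def formInner (α β : DiffForm m M 2) (x : M) : ℝ :=
  matPairing (gram g x (tangentFrame x)) (α.components x (tangentFrame x))
    (β.components x (tangentFrame x))

lemma normSq_eq_formInner (α : DiffForm m M 2) (x : M) : normSq g α x = formInner g α α x := rfl

/-- The pointwise inner product of two 2-forms in a chart. -/
lemma formInner_chart (α β : DiffForm m M 2) {c : M} {y : EuclideanSpace ℝ (Fin m)}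
    (hy : y ∈ (chartAt (EuclideanSpace ℝ (Fin m)) c).target) :
    formInner g α β ((chartAt (EuclideanSpace ℝ (Fin m)) c).symm y) =
      matPairing (metricCoord g c y) (formCoord α c y) (formCoord β c y) := by
  rw [metricCoord_eq, formCoord_eq, formCoord_eq, matPairing_conj]
  · rfl
  · rw [det_clmMatrix]
    exact (det_chartInvEndo_ne_zero hy).isUnit

/-- `‖α‖² + 2 ⟨α, β - α⟩ ≤ ‖β‖²`. -/
lemma normSq_add_le (α β : DiffForm m M 2) (x : M) :
    normSq g α x + 2 * (formInner g α β x - formInner g α α x) ≤ normSq g β x := by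
  have hG := posDef_gram g x
  -- The claim is the expansion of `0 ≤ ⟨β - α, β - α⟩`.
  have h := matPairing_self_nonneg hG
    (β.components x (tangentFrame x) - α.components x (tangentFrame x))
  rw [matPairing_sub_right, matPairing_sub_left, matPairing_sub_left,
    matPairing_comm hG _ (α.components x (tangentFrame x))] at h
  simp only [normSq_eq_formInner, formInner]
  linarith

lemma contDiffOn_raisedCoord {α : DiffForm m M 2} {c : M} {n : WithTop ℕ∞} (hn : n ≤ ∞)
    (hα : ∀ i j, ContDiffOn ℝ n (fun y ↦ formCoord α c y i j)
      (chartAt (EuclideanSpace ℝ (Fin m)) c).target) (i j : Fin m) :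
    ContDiffOn ℝ n (fun y ↦ raisedCoord g α c y i j)
      (chartAt (EuclideanSpace ℝ (Fin m)) c).target := by
  have hG : ∀ k l, ContDiffOn ℝ n (fun y ↦ (metricCoord g c y)⁻¹ k l)
      (chartAt (EuclideanSpace ℝ (Fin m)) c).target :=
    contDiffOn_matrix_inv (fun k l ↦ (contDiffOn_metricCoord g c k l).of_le hn)
      fun y hy ↦ (det_metricCoord_pos g hy).ne'
  have e : (fun y ↦ raisedCoord g α c y i j) = fun y ↦
      ∑ k, (∑ l, (metricCoord g c y)⁻¹ i l * formCoord α c y l k) * (metricCoord g c y)⁻¹ k j := by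
    ext y
    simp [raisedCoord, raise, Matrix.mul_apply, formCoord]
  rw [e]
  exact ContDiffOn.sum fun k _ ↦ (ContDiffOn.sum fun l _ ↦ (hG i l).mul (hα l k)).mul (hG k j)

lemma contDiffOn_formInner_chart {α β : DiffForm m M 2} {c : M} {n : WithTop ℕ∞} (hn : n ≤ ∞)
    (hα : ∀ i j, ContDiffOn ℝ n (fun y ↦ formCoord α c y i j)
      (chartAt (EuclideanSpace ℝ (Fin m)) c).target)
    (hβ : ∀ i j, ContDiffOn ℝ n (fun y ↦ formCoord β c y i j)
      (chartAt (EuclideanSpace ℝ (Fin m)) c).target) :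
    ContDiffOn ℝ n (fun y ↦ formInner g α β ((chartAt (EuclideanSpace ℝ (Fin m)) c).symm y))
      (chartAt (EuclideanSpace ℝ (Fin m)) c).target := by
  have h : ContDiffOn ℝ n (fun y ↦ (1 / 2) * ∑ i, ∑ j, formCoord α c y i j *
      raisedCoord g β c y i j) (chartAt (EuclideanSpace ℝ (Fin m)) c).target :=
    contDiffOn_const.mul (ContDiffOn.sum fun i _ ↦ ContDiffOn.sum fun j _ ↦
      (hα i j).mul (contDiffOn_raisedCoord g hn hβ i j))
  refine h.congr fun y hy ↦ ?_
  rw [formInner_chart g α β hy]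
  rfl

/-- The defining frame `tangentFrame x` comes from the preferred chart at `x` and need not vary
continuously. Frame independence allows computing near a point in one fixed chart, where all
components are continuous. -/
lemma continuous_formInner {α β : DiffForm m M 2}
    (hα : ∀ c i j, ContDiffOn ℝ 0 (fun y ↦ formCoord α c y i j)
      (chartAt (EuclideanSpace ℝ (Fin m)) c).target)
    (hβ : ∀ c i j, ContDiffOn ℝ 0 (fun y ↦ formCoord β c y i j)
      (chartAt (EuclideanSpace ℝ (Fin m)) c).target) :
    Continuous (formInner g α β) := by
  rw [continuous_iff_continuousAt]
  intro x
  let e : OpenPartialHomeomorph M (EuclideanSpace ℝ (Fin m)) := chartAt _ x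
  have hx : x ∈ e.source := mem_chart_source _ x
  have h1 : ContinuousAt (fun y ↦ formInner g α β (e.symm y)) (e x) :=
    (contDiffOn_formInner_chart g (by simp) (hα x) (hβ x)).continuousOn.continuousAt
      (e.open_target.mem_nhds (e.map_source hx))
  have h2 : ContinuousAt (fun z ↦ formInner g α β (e.symm (e z))) x :=
    ContinuousAt.comp (g := fun y ↦ formInner g α β (e.symm y)) h1 (e.continuousAt hx)
  refine h2.congr ?_
  filter_upwards [e.open_source.mem_nhds hx] with z hz
  rw [e.left_inv hz]

variable {n : ℕ} {N : Type*} [TopologicalSpace N] [ChartedSpace (EuclideanSpace ℝ (Fin n)) N]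
  [IsManifold (𝓡 n) ∞ N]

/-- Near each point, with a chart of `N` at the image, the components are those of `α` along the
coordinate map, evaluated on its partial derivatives. -/
lemma contDiffOn_formCoord_pullback {α : DiffForm n N 2} (hα : α.IsSmooth) {φ : M → N}
    (hφ : ContMDiff (𝓡 m) (𝓡 n) ∞ φ) (c : M) (i j : Fin m) :
    ContDiffOn ℝ ∞ (fun y ↦ formCoord (α.pullback φ) c y i j)
      (chartAt (EuclideanSpace ℝ (Fin m)) c).target := by
  intro y hy
  let e : OpenPartialHomeomorph M (EuclideanSpace ℝ (Fin m)) := chartAt _ c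
  let p : N := φ (e.symm y)
  let u : EuclideanSpace ℝ (Fin m) → EuclideanSpace ℝ (Fin n) := mapInCharts c p φ
  have hmem : ∀ᶠ z in 𝓝 y, z ∈ e.target ∧
      φ (e.symm z) ∈ (chartAt (EuclideanSpace ℝ (Fin n)) p).source := by
    refine (e.open_target.mem_nhds hy |> fun h ↦ (h : ∀ᶠ z in 𝓝 y, z ∈ e.target)).and ?_
    exact (hφ.continuous.continuousAt.comp (e.continuousAt_symm hy)).preimage_mem_nhds
      ((chartAt (EuclideanSpace ℝ (Fin n)) p).open_source.mem_nhds (mem_chart_source _ p))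
  have hu : ContDiffAt ℝ ∞ u y := contDiffAt_mapInCharts hy hφ.contMDiffAt hmem.self_of_nhds.2
  have hdu : ContDiffAt ℝ ∞ (fderiv ℝ u) y := hu.fderiv_right (by simp)
  have hω : ContDiffAt ℝ ∞ (fun z ↦ bilinOfForm (α.inChart p (u z))) y := by
    have h1 : ContDiffAt ℝ ∞ (α.inChart p) (u y) := (hα p).contDiffAt
      ((chartAt (EuclideanSpace ℝ (Fin n)) p).open_target.mem_nhds
        ((chartAt (EuclideanSpace ℝ (Fin n)) p).map_source hmem.self_of_nhds.2))
    exact contDiff_bilinOfForm.contDiffAt.comp y (h1.comp y hu)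
  have h2 : ContDiffAt ℝ ∞ (fun z ↦ bilinOfForm (α.inChart p (u z))
      (fderiv ℝ u z (EuclideanSpace.single i 1)) (fderiv ℝ u z (EuclideanSpace.single j 1))) y :=
    (hω.clm_apply (hdu.clm_apply contDiffAt_const)).clm_apply (hdu.clm_apply contDiffAt_const)
  refine (h2.congr_of_eventuallyEq ?_).contDiffWithinAt
  filter_upwards [hmem] with z hz
  rw [formCoord_apply, pullback_inChart_apply α hz.1 (hφ.mdifferentiableAt (by simp)) hz.2,
    bilinOfForm_apply]
  congr 1
  ext k
  fin_cases k <;> rfl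

end Forms

/-! ### The Riemannian volume measure in charts. -/

section Volume

variable {m : ℕ} {M : Type*} [TopologicalSpace M] [ChartedSpace (EuclideanSpace ℝ (Fin m)) M]
  [MeasurableSpace M] [BorelSpace M]

lemma aemeasurable_chart_symm (c : M) :
    AEMeasurable (chartAt (EuclideanSpace ℝ (Fin m)) c).symm
      (volume.restrict (chartAt (EuclideanSpace ℝ (Fin m)) c).target) :=
  (chartAt (EuclideanSpace ℝ (Fin m)) c).continuousOn_symm.aemeasurable
    (chartAt (EuclideanSpace ℝ (Fin m)) c).open_target.measurableSet

/-- The inverse chart is controlled only on its target, so measurability is obtained for its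
restriction to that subtype and carried back. -/
lemma measurableSet_target_inter_preimage (c : M) {s : Set M} (hs : MeasurableSet s) :
    MeasurableSet ((chartAt (EuclideanSpace ℝ (Fin m)) c).target ∩
      (chartAt (EuclideanSpace ℝ (Fin m)) c).symm ⁻¹' s) := by
  let e : OpenPartialHomeomorph M (EuclideanSpace ℝ (Fin m)) := chartAt _ c
  have h : Measurable (e.target.domRestrict e.symm) :=
    e.continuousOn_symm.domRestrict.measurable
  have h2 := e.open_target.measurableSet.subtype_image (h hs)
  convert h2 using 1
  ext y
  constructor
  · rintro ⟨hy, hys⟩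
    exact ⟨⟨y, hy⟩, hys, rfl⟩
  · rintro ⟨⟨z, hz⟩, hzs, rfl⟩
    exact ⟨hz, hzs⟩

variable [IsManifold (𝓡 m) ∞ M] (g : RiemannianMetric m M)

lemma chartVolume_apply (c : M) {s : Set M} (hs : MeasurableSet s) :
    chartVolume g c s = ∫⁻ y in (chartAt (EuclideanSpace ℝ (Fin m)) c).target ∩
      (chartAt (EuclideanSpace ℝ (Fin m)) c).symm ⁻¹' s, ENNReal.ofReal (volDensity g c y) := by
  rw [chartVolume, Measure.map_apply_of_aemeasurable
    ((aemeasurable_chart_symm c).mono_ac (withDensity_absolutelyContinuous _ _)) hs,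
    withDensity_apply', Measure.restrict_restrict'
      (chartAt (EuclideanSpace ℝ (Fin m)) c).open_target.measurableSet, inter_comm]

/-- The chart volumes agree on overlaps of chart domains. -/
lemma chartVolume_eq_of_subset (c c' : M) {s : Set M} (hs : MeasurableSet s)
    (hc : s ⊆ (chartAt (EuclideanSpace ℝ (Fin m)) c).source)
    (hc' : s ⊆ (chartAt (EuclideanSpace ℝ (Fin m)) c').source) :
    chartVolume g c s = chartVolume g c' s := by
  let e : OpenPartialHomeomorph M (EuclideanSpace ℝ (Fin m)) := chartAt _ c
  let e' : OpenPartialHomeomorph M (EuclideanSpace ℝ (Fin m)) := chartAt _ c'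
  let τ : EuclideanSpace ℝ (Fin m) → EuclideanSpace ℝ (Fin m) := mapInCharts c c' (id : M → M)
  have hτ : ∀ y, τ y = e' (e.symm y) := fun y ↦ rfl
  have himg : τ '' (e.target ∩ e.symm ⁻¹' s) = e'.target ∩ e'.symm ⁻¹' s := by
    ext z
    constructor
    · rintro ⟨y, ⟨-, hys⟩, rfl⟩
      refine ⟨e'.map_source (hc' hys), ?_⟩
      rw [mem_preimage, hτ, e'.left_inv (hc' hys)]
      exact hys
    · rintro ⟨hz, hzs⟩
      refine ⟨e (e'.symm z), ⟨e.map_source (hc hzs), ?_⟩, ?_⟩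
      · rw [mem_preimage, e.left_inv (hc hzs)]
        exact hzs
      · rw [hτ, e.left_inv (hc hzs), e'.right_inv hz]
  have hinj : InjOn τ (e.target ∩ e.symm ⁻¹' s) := by
    rintro y ⟨hy, hys⟩ z ⟨hz, hzs⟩ h
    have h1 : e.symm y = e.symm z := e'.injOn (hc' hys) (hc' hzs) h
    exact e.symm.injOn hy hz h1
  have hder : ∀ y ∈ e.target ∩ e.symm ⁻¹' s,
      HasFDerivWithinAt τ (fderiv ℝ τ y) (e.target ∩ e.symm ⁻¹' s) y := fun y hy ↦
    ((contDiffAt_mapInCharts (φ := (id : M → M)) hy.1 contMDiffAt_id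
      (hc' hy.2)).differentiableAt (by simp)).hasFDerivAt.hasFDerivWithinAt
  -- Change of variables along the transition map, whose Jacobian is the ratio of the two densities.
  rw [chartVolume_apply g c hs, chartVolume_apply g c' hs, ← himg,
    lintegral_image_eq_lintegral_abs_det_fderiv_mul volume
      (measurableSet_target_inter_preimage c hs) hder hinj]
  refine setLIntegral_congr_fun (measurableSet_target_inter_preimage c hs) fun y hy ↦ ?_
  rw [volDensity_change g hy.1 (hc' hy.2), ENNReal.ofReal_mul (abs_nonneg _)]

lemma chartVolume_restrict_source (c : M) :
    (chartVolume g c).restrict (chartAt (EuclideanSpace ℝ (Fin m)) c).source =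
      chartVolume g c := by
  let e : OpenPartialHomeomorph M (EuclideanSpace ℝ (Fin m)) := chartAt _ c
  ext s hs
  rw [Measure.restrict_apply hs, chartVolume_apply g c (hs.inter e.open_source.measurableSet),
    chartVolume_apply g c hs]
  congr 2
  ext y
  exact ⟨fun h ↦ ⟨h.1, h.2.1⟩, fun h ↦ ⟨h.1, h.2, e.map_target h.1⟩⟩

/-- The Riemannian volume restricts to the chart volume on chart domains. -/
theorem riemannianVolume_restrict_source (c : M) :
    (riemannianVolume g).restrict (chartAt (EuclideanSpace ℝ (Fin m)) c).source =
      chartVolume g c := by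
  let U := (chartAt (EuclideanSpace ℝ (Fin m)) c).source
  have hU : MeasurableSet U := (chartAt (EuclideanSpace ℝ (Fin m)) c).open_source.measurableSet
  apply le_antisymm
  · have h1 : ∀ c', (chartVolume g c').restrict U ≤ chartVolume g c := by
      intro c'
      refine Measure.le_iff.2 fun s hs ↦ ?_
      have hU' := (chartAt (EuclideanSpace ℝ (Fin m)) c').open_source.measurableSet
      rw [Measure.restrict_apply hs, ← chartVolume_restrict_source g c',
        Measure.restrict_apply (hs.inter hU),
        chartVolume_eq_of_subset g c' c ((hs.inter hU).inter hU') inter_subset_right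
          (inter_subset_left.trans inter_subset_right)]
      exact measure_mono (inter_subset_left.trans inter_subset_left)
    -- A supremum of measures is not computed setwise, but it is bounded by any common upper bound.
    -- This one dominates every chart volume and restricts on `U` to at most `chartVolume g c`.
    have h2 : riemannianVolume g ≤ chartVolume g c + (riemannianVolume g).restrict Uᶜ := by
      refine iSup_le fun c' ↦ ?_
      rw [← Measure.restrict_add_restrict_compl (μ := chartVolume g c') hU]
      exact add_le_add (h1 c') (Measure.restrict_mono subset_rfl (le_iSup (chartVolume g) c'))
    have h3 := Measure.restrict_mono (subset_refl U) h2
    rw [Measure.restrict_add, Measure.restrict_restrict hU, inter_compl_self,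
      Measure.restrict_empty, add_zero] at h3
    exact h3.trans Measure.restrict_le_self
  · rw [← chartVolume_restrict_source g c]
    exact Measure.restrict_mono subset_rfl (le_iSup (chartVolume g) c)

/-- The density is continuous, hence integrable on a closed coordinate ball inside the chart target.
On compact `M` this makes continuous functions integrable. -/
instance isLocallyFiniteMeasure_riemannianVolume :
    IsLocallyFiniteMeasure (riemannianVolume g) := by
  refine ⟨fun x ↦ ?_⟩
  let e : OpenPartialHomeomorph M (EuclideanSpace ℝ (Fin m)) := chartAt _ x
  have hx : x ∈ e.source := mem_chart_source _ x
  obtain ⟨r, hr, hball⟩ := Metric.nhds_basis_closedBall.mem_iff.1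
    (e.open_target.mem_nhds (e.map_source hx))
  let s : Set M := e.source ∩ e ⁻¹' Metric.ball (e x) r
  have hs : IsOpen s := e.isOpen_inter_preimage Metric.isOpen_ball
  refine ⟨s, hs.mem_nhds ⟨hx, Metric.mem_ball_self hr⟩, ?_⟩
  rw [← Measure.restrict_eq_self _ (inter_subset_left : s ⊆ e.source),
    riemannianVolume_restrict_source g x, chartVolume_apply g x hs.measurableSet]
  have hsub : e.target ∩ e.symm ⁻¹' s ⊆ Metric.closedBall (e x) r := by
    rintro y ⟨hy, -, hy2⟩
    rw [mem_preimage, e.right_inv hy] at hy2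
    exact Metric.ball_subset_closedBall hy2
  refine (lintegral_mono_set hsub).trans_lt ?_
  have hint : IntegrableOn (volDensity g x) (Metric.closedBall (e x) r) :=
    ((contDiffOn_volDensity g x).continuousOn.mono hball).integrableOn_compact
      (isCompact_closedBall _ _)
  exact hint.lintegral_lt_top

/-- Integration over a chart domain in coordinates. -/
theorem integral_riemannianVolume_eq (c : M) {F : M → ℝ} (hF : Continuous F)
    (h0 : ∀ x ∉ (chartAt (EuclideanSpace ℝ (Fin m)) c).source, F x = 0) :
    ∫ x, F x ∂(riemannianVolume g) = ∫ y in (chartAt (EuclideanSpace ℝ (Fin m)) c).target,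
      volDensity g c y * F ((chartAt (EuclideanSpace ℝ (Fin m)) c).symm y) := by
  have ht := (chartAt (EuclideanSpace ℝ (Fin m)) c).open_target.measurableSet
  rw [← setIntegral_eq_integral_of_forall_compl_eq_zero h0, riemannianVolume_restrict_source,
    chartVolume, integral_map
      ((aemeasurable_chart_symm c).mono_ac (withDensity_absolutelyContinuous _ _))
      hF.aestronglyMeasurable, integral_withDensity_eq_integral_toReal_smul₀]
  · refine setIntegral_congr_fun ht fun y hy ↦ ?_
    simp only [smul_eq_mul]
    rw [ENNReal.toReal_ofReal (volDensity_pos g hy).le]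
  · exact ((contDiffOn_volDensity g c).continuousOn.aemeasurable ht).ennreal_ofReal
  · exact Eventually.of_forall fun _ ↦ ENNReal.ofReal_lt_top

end Volume

/-! ### Invariance of the pairing with a coclosed form under modifications in a coordinate ball. -/

section Local

variable {m : ℕ} {M : Type*} [TopologicalSpace M] [ChartedSpace (EuclideanSpace ℝ (Fin m)) M]
variable {n : ℕ} {N : Type*} [TopologicalSpace N] [ChartedSpace (EuclideanSpace ℝ (Fin n)) N]

lemma pullback_eq_of_eventuallyEq (α : DiffForm n N 2) {f f' : M → N} {x : M}
    (h : f =ᶠ[𝓝 x] f') : α.pullback (m := m) f x = α.pullback (m := m) f' x := by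
  let a : N → (Fin 2 → EuclideanSpace ℝ (Fin n)) → ℝ := fun q w ↦ α q w
  let L : EuclideanSpace ℝ (Fin m) →L[ℝ] EuclideanSpace ℝ (Fin n) := mfderiv (𝓡 m) (𝓡 n) f x
  let L' : EuclideanSpace ℝ (Fin m) →L[ℝ] EuclideanSpace ℝ (Fin n) := mfderiv (𝓡 m) (𝓡 n) f' x
  have hL : L = L' := h.mfderiv_eq
  ext v
  change a (f x) (fun i ↦ L (v i)) = a (f' x) (fun i ↦ L' (v i))
  rw [hL, h.self_of_nhds]

lemma formCoord_antisymm (α : DiffForm m M 2) (c : M) (y : EuclideanSpace ℝ (Fin m)) :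
    (formCoord α c y).transpose = -formCoord α c y := by
  ext i j
  rw [Matrix.transpose_apply, Matrix.neg_apply, formCoord_apply, formCoord_apply,
    alternating_two_swap]

variable [IsManifold (𝓡 m) ∞ M] (g : RiemannianMetric m M)

lemma metricBilin_comm (x : M) (v w : EuclideanSpace ℝ (Fin m)) :
    metricBilin g x v w = metricBilin g x w v :=
  g.symm x v w

lemma metricBilin_pos (x : M) {v : EuclideanSpace ℝ (Fin m)} (hv : v ≠ 0) :
    0 < metricBilin g x v v :=
  g.pos x v hv

lemma posDef_metricCoord {c : M} {y : EuclideanSpace ℝ (Fin m)}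
    (hy : y ∈ (chartAt (EuclideanSpace ℝ (Fin m)) c).target) : (metricCoord g c y).PosDef := by
  have h : metricCoord g c y = frameMatrix
      ((metricBilin g ((chartAt (EuclideanSpace ℝ (Fin m)) c).symm y)).bilinearComp
        (chartInvEndo c y) (chartInvEndo c y)) := rfl
  rw [h]
  refine posDef_frameMatrix (fun v w ↦ ?_) fun v hv ↦ ?_
  · rw [ContinuousLinearMap.bilinearComp_apply, ContinuousLinearMap.bilinearComp_apply,
      metricBilin_comm]
  · rw [ContinuousLinearMap.bilinearComp_apply]
    refine metricBilin_pos g _ fun h0 ↦ hv ?_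
    have h1 := congrArg (fun L ↦ L v) (chartEndo_comp_chartInvEndo hy)
    rw [ContinuousLinearMap.comp_apply, h0, map_zero] at h1
    exact h1.symm

/-- Congruence by the symmetric matrix `G⁻¹` preserves antisymmetry. Consequently the two halves of
an exterior derivative contribute equally to the pairing. -/
lemma raisedCoord_antisymm (α : DiffForm m M 2) {c : M} {y : EuclideanSpace ℝ (Fin m)}
    (hy : y ∈ (chartAt (EuclideanSpace ℝ (Fin m)) c).target) (i j : Fin m) :
    raisedCoord g α c y j i = -raisedCoord g α c y i j := by
  have hG : (metricCoord g c y)⁻¹.transpose = (metricCoord g c y)⁻¹ := by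
    simpa [Matrix.IsHermitian] using (posDef_metricCoord g hy).isHermitian.inv
  have h : (raisedCoord g α c y).transpose = -raisedCoord g α c y := by
    change ((metricCoord g c y)⁻¹ * formCoord α c y * (metricCoord g c y)⁻¹).transpose =
      -((metricCoord g c y)⁻¹ * formCoord α c y * (metricCoord g c y)⁻¹)
    rw [Matrix.transpose_mul, Matrix.transpose_mul, hG, formCoord_antisymm]
    simp [Matrix.mul_assoc]
  exact congrFun (congrFun h i) j

/-- In a chart, a coclosed 2-form is given by a divergence-free bivector density. -/
lemma IsCoclosed.divergence_eq_zero {α : DiffForm m M 2} (hα : IsCoclosed g α) {c : M}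
    {y : EuclideanSpace ℝ (Fin m)} (hy : y ∈ (chartAt (EuclideanSpace ℝ (Fin m)) c).target)
    (j : Fin m) : ∑ i, fderiv ℝ (fun z ↦ volDensity g c z * raisedCoord g α c z i j) y
      (EuclideanSpace.single i 1) = 0 := by
  let w : Fin m → ℝ := fun j ↦ (volDensity g c y)⁻¹ *
    ∑ i, fderiv ℝ (fun z ↦ volDensity g c z * raisedCoord g α c z i j) y
      (EuclideanSpace.single i 1)
  -- The components of the coderivative are, up to sign, the metric matrix applied to the normalized
  -- divergence, and that matrix is invertible.
  have hw : (metricCoord g c y).mulVec w = 0 := by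
    ext k
    exact neg_eq_zero.1 (hα c y hy k)
  have h := congrFun (Matrix.eq_zero_of_mulVec_eq_zero (det_metricCoord_pos g hy).ne' hw) j
  exact (mul_eq_zero.1 h).resolve_left (inv_ne_zero (volDensity_pos g hy).ne')

variable [IsManifold (𝓡 n) ∞ N]

/-- A primitive of a 2-form on a coordinate ball pulls back to a primitive of the pullback. -/
lemma formCoord_pullback_eq_fderiv {α : DiffForm n N 2} {p : N} {a : EuclideanSpace ℝ (Fin n)}
    {r : ℝ} {l : EuclideanSpace ℝ (Fin n) → EuclideanSpace ℝ (Fin n) →L[ℝ] ℝ}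
    (hl : ContDiff ℝ 1 l) (hprim : ∀ z ∈ Metric.ball a r, ∀ u v,
      α.inChart p z ![u, v] = fderiv ℝ l z u v - fderiv ℝ l z v u)
    {c : M} {f : M → N} {y : EuclideanSpace ℝ (Fin m)}
    (hy : y ∈ (chartAt (EuclideanSpace ℝ (Fin m)) c).target)
    (hf : ContMDiffAt (𝓡 m) (𝓡 n) ∞ f ((chartAt (EuclideanSpace ℝ (Fin m)) c).symm y))
    (hp : f ((chartAt (EuclideanSpace ℝ (Fin m)) c).symm y) ∈
      (chartAt (EuclideanSpace ℝ (Fin n)) p).source)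
    (hball : mapInCharts (n := n) c p f y ∈ Metric.ball a r) (i j : Fin m) :
    formCoord (α.pullback f) c y i j =
      fderiv ℝ (fun z ↦ (l (mapInCharts c p f z)).comp (fderiv ℝ (mapInCharts (n := n) c p f) z)) y
        (EuclideanSpace.single i 1) (EuclideanSpace.single j 1) -
      fderiv ℝ (fun z ↦ (l (mapInCharts c p f z)).comp (fderiv ℝ (mapInCharts (n := n) c p f) z)) y
        (EuclideanSpace.single j 1) (EuclideanSpace.single i 1) := by
  rw [fderiv_pullback_antisymm (hl.differentiable one_ne_zero _)
    ((contDiffAt_mapInCharts hy hf hp).of_le (by norm_cast)), ← hprim _ hball, formCoord_apply,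
    pullback_inChart_apply α hy (hf.mdifferentiableAt (by simp)) hp]
  congr 1
  ext k
  fin_cases k <;> rfl

variable [T2Space M] [CompactSpace M] [MeasurableSpace M] [BorelSpace M]

/-- If two maps agree outside a compact subset of a chart domain, which both of them map into a
coordinate ball, then the inner products of their pullbacks of a closed form with a coclosed form
have the same integral. -/
theorem integral_formInner_pullback_eq {α : DiffForm m M 2} (hα : IsCoclosed g α)
    (hαs : ∀ c i j, ContDiffOn ℝ ∞ (fun y ↦ formCoord α c y i j)
      (chartAt (EuclideanSpace ℝ (Fin m)) c).target)
    (Ω : SymplecticForm n N) {f f' : M → N} (hf : ContMDiff (𝓡 m) (𝓡 n) ∞ f)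
    (hf' : ContMDiff (𝓡 m) (𝓡 n) ∞ f') {c : M} {p : N} {a : EuclideanSpace ℝ (Fin n)}
    {r R : ℝ} (hr : 0 < r) (hrR : r < R)
    (hR : Metric.closedBall a R ⊆ (chartAt (EuclideanSpace ℝ (Fin n)) p).target)
    {K : Set M} (hK : IsCompact K) (hKc : K ⊆ (chartAt (EuclideanSpace ℝ (Fin m)) c).source)
    (heq : ∀ x ∉ K, f x = f' x)
    (hfK : ∀ x ∈ K, f x ∈ (chartAt (EuclideanSpace ℝ (Fin n)) p).source ∧
      chartAt (EuclideanSpace ℝ (Fin n)) p (f x) ∈ Metric.ball a r)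
    (hfK' : ∀ x ∈ K, f' x ∈ (chartAt (EuclideanSpace ℝ (Fin n)) p).source ∧
      chartAt (EuclideanSpace ℝ (Fin n)) p (f' x) ∈ Metric.ball a r) :
    ∫ x, formInner g α (Ω.form.pullback f) x ∂(riemannianVolume g) =
      ∫ x, formInner g α (Ω.form.pullback f') x ∂(riemannianVolume g) := by
  let e : OpenPartialHomeomorph M (EuclideanSpace ℝ (Fin m)) := chartAt _ c
  let e' : OpenPartialHomeomorph N (EuclideanSpace ℝ (Fin n)) := chartAt _ p
  obtain ⟨l, hl, hprim⟩ := exists_primitive_of_closed e'.open_target (Ω.isSmooth p)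
    (Ω.isClosed p) hr hrR hR
  let B : Set N := e'.source ∩ e' ⁻¹' Metric.ball a r
  have hB : IsOpen B := e'.isOpen_inter_preimage Metric.isOpen_ball
  -- On `S` both maps land in the ball carrying the primitive `l`, so both pullbacks of `l` make
  -- sense there.
  let S : Set (EuclideanSpace ℝ (Fin m)) := e.target ∩ e.symm ⁻¹' (f ⁻¹' B ∩ f' ⁻¹' B)
  have hS : IsOpen S := e.isOpen_inter_preimage_symm
    ((hB.preimage hf.continuous).inter (hB.preimage hf'.continuous))
  let K' : Set (EuclideanSpace ℝ (Fin m)) := e '' K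
  have hK' : IsCompact K' := hK.image_of_continuousOn (e.continuousOn.mono hKc)
  have hKS : K' ⊆ S := by
    rintro _ ⟨x, hx, rfl⟩
    refine ⟨e.map_source (hKc hx), ?_⟩
    rw [mem_preimage, e.left_inv (hKc hx)]
    exact ⟨hfK x hx, hfK' x hx⟩
  have hoff : ∀ y ∈ e.target, y ∉ K' → e.symm y ∉ K := fun y hy hyK h ↦
    hyK ⟨e.symm y, h, e.right_inv hy⟩
  have hloc : ∀ x ∉ K, f =ᶠ[𝓝 x] f' := fun x hx ↦ by
    filter_upwards [hK.isClosed.isOpen_compl.mem_nhds hx] with z hz using heq z hz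
  have hpull : ∀ x ∉ K, Ω.form.pullback (m := m) f x = Ω.form.pullback (m := m) f' x := fun x hx ↦
    pullback_eq_of_eventuallyEq _ (hloc x hx)
  have hinner : ∀ x ∉ K, formInner g α (Ω.form.pullback f) x -
      formInner g α (Ω.form.pullback f') x = 0 := fun x hx ↦ by
    simp only [formInner, DiffForm.components, hpull x hx, sub_self]
  let u : (M → N) → EuclideanSpace ℝ (Fin m) → EuclideanSpace ℝ (Fin n) := mapInCharts c p
  let b : (M → N) → EuclideanSpace ℝ (Fin m) → EuclideanSpace ℝ (Fin m) →L[ℝ] ℝ :=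
    fun h z ↦ (l (u h z)).comp (fderiv ℝ (u h) z)
  have hb : ∀ h : M → N, ContMDiff (𝓡 m) (𝓡 n) ∞ h → (∀ y ∈ S, h (e.symm y) ∈ B) →
      ContDiffOn ℝ 1 (b h) S := by
    intro h hh hhB y hy
    have h1 : ContDiffAt ℝ ∞ (u h) y := contDiffAt_mapInCharts hy.1 hh.contMDiffAt (hhB y hy).1
    have h2 : ContDiffAt ℝ 1 (fderiv ℝ (u h)) y := h1.fderiv_right (by norm_cast)
    have h3 : ContDiffAt ℝ 1 (fun z ↦ l (u h z)) y :=
      hl.contDiffAt.comp y (h1.of_le (by norm_cast))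
    exact (h3.clm_comp h2).contDiffWithinAt
  have hbf := hb f hf fun y hy ↦ hy.2.1
  have hbf' := hb f' hf' fun y hy ↦ hy.2.2
  -- Difference of the two pulled-back primitives. It vanishes on `S` away from `K'`, so extension
  -- by zero keeps it `C¹` and compactly supported.
  let β : EuclideanSpace ℝ (Fin m) → EuclideanSpace ℝ (Fin m) →L[ℝ] ℝ :=
    S.indicator fun z ↦ b f z - b f' z
  have hβ0 : ∀ y ∈ S, y ∉ K' → b f y - b f' y = 0 := by
    intro y hy hyK
    have h1 : u f =ᶠ[𝓝 y] u f' := by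
      have := (e.continuousAt_symm hy.1).eventually (hloc _ (hoff y hy.1 hyK))
      filter_upwards [this] with z hz
      exact congrArg e' hz
    simp only [b, h1.fderiv_eq, h1.self_of_nhds, sub_self]
  have hβ : ContDiff ℝ 1 β :=
    contDiff_indicator hS hK'.isClosed hKS (hbf.sub hbf') hβ0
  have hβs : tsupport β ⊆ K' := by
    refine closure_minimal (fun y hy ↦ ?_) hK'.isClosed
    by_contra hyK
    refine hy ?_
    by_cases hyS : y ∈ S
    · exact (indicator_of_mem hyS _).trans (hβ0 y hyS hyK)
    · exact indicator_of_notMem hyS _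
  have hβc : HasCompactSupport β := hK'.of_isClosed_subset (isClosed_tsupport β) hβs
  have hfc : Continuous (formInner g α (Ω.form.pullback f)) := continuous_formInner g
    (fun c i j ↦ (hαs c i j).of_le (by simp))
    (fun c i j ↦ (contDiffOn_formCoord_pullback Ω.isSmooth hf c i j).of_le (by simp))
  have hfc' : Continuous (formInner g α (Ω.form.pullback f')) := continuous_formInner g
    (fun c i j ↦ (hαs c i j).of_le (by simp))
    (fun c i j ↦ (contDiffOn_formCoord_pullback Ω.isSmooth hf' c i j).of_le (by simp))
  rw [← sub_eq_zero, ← integral_sub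
    (hfc.integrable_of_hasCompactSupport (HasCompactSupport.of_compactSpace _))
    (hfc'.integrable_of_hasCompactSupport (HasCompactSupport.of_compactSpace _)),
    integral_riemannianVolume_eq g c (F := fun x ↦ formInner g α (Ω.form.pullback f) x -
      formInner g α (Ω.form.pullback f') x) (hfc.sub hfc')
      fun x hx ↦ hinner x fun h ↦ hx (hKc h)]
  let A : EuclideanSpace ℝ (Fin m) → Matrix (Fin m) (Fin m) ℝ := fun y ↦
    Matrix.of fun i j ↦ volDensity g c y * raisedCoord g α c y i j
  have hA : ∀ i j, ContDiffOn ℝ 1 (fun y ↦ A y i j) e.target := fun i j ↦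
    ((contDiffOn_volDensity g c).of_le (by simp)).mul
      (contDiffOn_raisedCoord g (by simp) (fun k l ↦ (hαs c k l).of_le (by simp)) i j)
  -- The zero on the right is replaced by the divergence integral against `β`; it remains to compare
  -- the integrands pointwise.
  rw [← integral_divergenceFree_mul_fderiv_eq_zero e.open_target hA
    (fun y hy j ↦ hα.divergence_eq_zero g hy j) hβ hβc (hβs.trans (hKS.trans inter_subset_left)),
    ← integral_indicator e.open_target.measurableSet]
  congr 1
  ext y
  have hfd0 : y ∉ K' → fderiv ℝ β y = 0 := fun hy ↦ by
    have : β =ᶠ[𝓝 y] fun _ ↦ 0 := by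
      filter_upwards [hK'.isClosed.isOpen_compl.mem_nhds hy] with z hz
      exact image_eq_zero_of_notMem_tsupport fun h ↦ hz (hβs h)
    rw [this.fderiv_eq]
    simp
  by_cases hyK : y ∈ K'
  swap
  · rw [hfd0 hyK]
    by_cases hy : y ∈ e.target
    · rw [indicator_of_mem hy]
      simp [hinner (e.symm y) (hoff y hy hyK), e]
    · rw [indicator_of_notMem hy]
      simp
  have hyS : y ∈ S := hKS hyK
  have hy : y ∈ e.target := hyS.1
  have hG := posDef_metricCoord g hy
  have hfd : fderiv ℝ β y = fderiv ℝ (b f) y - fderiv ℝ (b f') y := by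
    have : β =ᶠ[𝓝 y] fun z ↦ b f z - b f' z := by
      filter_upwards [hS.mem_nhds hyS] with z hz using indicator_of_mem hz _
    rw [this.fderiv_eq, fderiv_fun_sub
      ((hbf.contDiffAt (hS.mem_nhds hyS)).differentiableAt one_ne_zero)
      ((hbf'.contDiffAt (hS.mem_nhds hyS)).differentiableAt one_ne_zero)]
  have hcoord : ∀ i j, (formCoord (Ω.form.pullback f) c y - formCoord (Ω.form.pullback f') c y) i j =
      fderiv ℝ β y (EuclideanSpace.single i 1) (EuclideanSpace.single j 1) -
        fderiv ℝ β y (EuclideanSpace.single j 1) (EuclideanSpace.single i 1) := by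
    intro i j
    rw [Matrix.sub_apply, formCoord_pullback_eq_fderiv hl hprim hy hf.contMDiffAt hyS.2.1.1
      hyS.2.1.2, formCoord_pullback_eq_fderiv hl hprim hy hf'.contMDiffAt hyS.2.2.1 hyS.2.2.2, hfd]
    simp only [sub_apply]
    ring
  rw [indicator_of_mem hy, formInner_chart g _ _ hy, formInner_chart g _ _ hy,
    ← matPairing_sub_right, matPairing_comm hG]
  have hsum : volDensity g c y * matPairing (metricCoord g c y)
      (formCoord (Ω.form.pullback f) c y - formCoord (Ω.form.pullback f') c y) (formCoord α c y) =
      (1 / 2) * (∑ i, ∑ j, A y i j *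
        fderiv ℝ β y (EuclideanSpace.single i 1) (EuclideanSpace.single j 1) -
        ∑ i, ∑ j, A y i j *
          fderiv ℝ β y (EuclideanSpace.single j 1) (EuclideanSpace.single i 1)) := by
    simp only [matPairing, hcoord, ← Finset.sum_sub_distrib, ← mul_sub]
    rw [mul_left_comm, Finset.mul_sum]
    congr 1
    refine Finset.sum_congr rfl fun i _ ↦ ?_
    rw [Finset.mul_sum]
    refine Finset.sum_congr rfl fun j _ ↦ ?_
    change _ = volDensity g c y * raisedCoord g α c y i j * _
    rw [raisedCoord]
    simp only [formCoord]
    ring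
  -- Antisymmetry of `A` makes the second sum the negative of the first, which absorbs the factor `1
  -- / 2` in the inner product.
  have hswap : ∑ i, ∑ j, A y i j *
      fderiv ℝ β y (EuclideanSpace.single j 1) (EuclideanSpace.single i 1) =
      -∑ i, ∑ j, A y i j *
        fderiv ℝ β y (EuclideanSpace.single i 1) (EuclideanSpace.single j 1) := by
    rw [Finset.sum_comm, ← Finset.sum_neg_distrib]
    refine Finset.sum_congr rfl fun i _ ↦ ?_
    rw [← Finset.sum_neg_distrib]
    refine Finset.sum_congr rfl fun j _ ↦ ?_
    simp only [A, Matrix.of_apply, raisedCoord_antisymm g α hy i j]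
    ring
  rw [hsum, hswap]
  ring

end Local

/-! ### Local modification of maps by interpolation in coordinate balls. -/

section Patches

variable {m : ℕ} {M : Type*} [TopologicalSpace M] [ChartedSpace (EuclideanSpace ℝ (Fin m)) M]
variable {n : ℕ} {N : Type*} [TopologicalSpace N] [ChartedSpace (EuclideanSpace ℝ (Fin n)) N]

variable (m n) in
/-- A smooth cutoff function supported in a chart domain of `M`, whose support is mapped by `h`
into a coordinate ball of `N`. -/
structure Patch (h : C(M, N)) where
  /-- The centre of the chart of `M`. -/
  base : M
  /-- The centre of the chart of `N`. -/
  ctr : N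
  /-- The radius of the coordinate ball. -/
  r : ℝ
  /-- The radius of a larger coordinate ball. -/
  R : ℝ
  r_pos : 0 < r
  r_lt : r < R
  closedBall_subset : Metric.closedBall (chartAt (EuclideanSpace ℝ (Fin n)) ctr ctr) R ⊆
    (chartAt (EuclideanSpace ℝ (Fin n)) ctr).target
  /-- The cutoff function. -/
  ρ : M → ℝ
  smooth : ContMDiff (𝓡 m) 𝓘(ℝ) ∞ ρ
  mem_Icc : ∀ x, ρ x ∈ Icc (0 : ℝ) 1
  tsupport_subset : tsupport ρ ⊆ (chartAt (EuclideanSpace ℝ (Fin m)) base).source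
  fits : ∀ x ∈ tsupport ρ, h x ∈ (chartAt (EuclideanSpace ℝ (Fin n)) ctr).source ∧
    chartAt (EuclideanSpace ℝ (Fin n)) ctr (h x) ∈
      Metric.ball (chartAt (EuclideanSpace ℝ (Fin n)) ctr ctr) r

namespace Patch

variable {h : C(M, N)} (P : Patch m n h)

/-- The chart of the target manifold. -/
def chart : OpenPartialHomeomorph N (EuclideanSpace ℝ (Fin n)) := chartAt _ P.ctr

/-- The ball in coordinates. -/
def coordBall : Set (EuclideanSpace ℝ (Fin n)) := Metric.ball (P.chart P.ctr) P.r

/-- The coordinate ball as a subset of the target manifold. -/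
def ball : Set N := P.chart.source ∩ P.chart ⁻¹' P.coordBall

/-- The open set where the cutoff function is locally equal to one. -/
def core : Set M := {x | P.ρ =ᶠ[𝓝 x] 1}

lemma isOpen_core : IsOpen P.core := isOpen_setOfPred_eventually_nhds

lemma isOpen_ball : IsOpen P.ball := P.chart.isOpen_inter_preimage Metric.isOpen_ball

lemma coordBall_subset : P.coordBall ⊆ P.chart.target :=
  (Metric.ball_subset_closedBall.trans (Metric.closedBall_subset_closedBall P.r_lt.le)).trans
    P.closedBall_subset

lemma core_subset : P.core ⊆ tsupport P.ρ := fun x hx ↦ subset_tsupport _ <| by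
  have : P.ρ x = 1 := hx.self_of_nhds
  simp [this]

/-- Interpolation in coordinates. -/
def interp (x : M) (q : N) (v : EuclideanSpace ℝ (Fin n)) : N :=
  P.chart.symm ((1 - P.ρ x) • P.chart q + P.ρ x • v)

/-- Modification of a map on the support of the cutoff function. -/
def modify (f : M → N) (w : M → EuclideanSpace ℝ (Fin n)) (x : M) : N :=
  open scoped Classical in if x ∈ tsupport P.ρ then P.interp x (f x) (w x) else f x

/-- Convexity of the coordinate ball keeps the interpolation inside the chart target. -/
lemma interp_coord_mem {x : M} {q : N} {v : EuclideanSpace ℝ (Fin n)} (hq : q ∈ P.ball)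
    (hv : v ∈ P.coordBall) : (1 - P.ρ x) • P.chart q + P.ρ x • v ∈ P.coordBall :=
  (convex_ball _ _) hq.2 hv (sub_nonneg.2 (P.mem_Icc x).2) (P.mem_Icc x).1 (sub_add_cancel _ _)

lemma interp_mem {x : M} {q : N} {v : EuclideanSpace ℝ (Fin n)} (hq : q ∈ P.ball)
    (hv : v ∈ P.coordBall) : P.interp x q v ∈ P.ball := by
  have h1 := P.interp_coord_mem (x := x) hq hv
  refine ⟨P.chart.map_target (P.coordBall_subset h1), ?_⟩
  rw [mem_preimage, interp, P.chart.right_inv (P.coordBall_subset h1)]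
  exact h1

lemma interp_self {x : M} {q : N} (hq : q ∈ P.chart.source) : P.interp x q (P.chart q) = q := by
  rw [interp, ← add_smul, sub_add_cancel, one_smul, P.chart.left_inv hq]

lemma interp_of_eq_zero {x : M} {q : N} {v : EuclideanSpace ℝ (Fin n)} (hq : q ∈ P.chart.source)
    (hx : P.ρ x = 0) : P.interp x q v = q := by
  rw [interp, hx, sub_zero, one_smul, zero_smul, add_zero, P.chart.left_inv hq]

lemma modify_of_notMem {f : M → N} {w : M → EuclideanSpace ℝ (Fin n)} {x : M}
    (hx : x ∉ tsupport P.ρ) : P.modify f w x = f x := if_neg hx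

lemma modify_of_mem {f : M → N} {w : M → EuclideanSpace ℝ (Fin n)} {x : M}
    (hx : x ∈ tsupport P.ρ) : P.modify f w x = P.interp x (f x) (w x) := if_pos hx

lemma modify_eventuallyEq {f : M → N} {w : M → EuclideanSpace ℝ (Fin n)} {x : M}
    (hx : x ∉ tsupport P.ρ) : P.modify f w =ᶠ[𝓝 x] f := by
  filter_upwards [(isClosed_tsupport P.ρ).isOpen_compl.mem_nhds hx] with z hz
  exact P.modify_of_notMem hz

/-- Off the support of `ρ` the interpolation returns `f` itself, as long as `f` stays in the ball.
The two branches of `modify` thus merge into one formula, and regularity at the boundary of the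
support is automatic. -/
lemma modify_eventuallyEq_interp {f : M → N} {w : M → EuclideanSpace ℝ (Fin n)} {x : M}
    (hf : ContinuousAt f x) (hx : f x ∈ P.ball) :
    P.modify f w =ᶠ[𝓝 x] fun z ↦ P.interp z (f z) (w z) := by
  filter_upwards [hf.preimage_mem_nhds (P.isOpen_ball.mem_nhds hx)] with z hz
  by_cases hzK : z ∈ tsupport P.ρ
  · exact P.modify_of_mem hzK
  · rw [P.modify_of_notMem hzK, P.interp_of_eq_zero hz.1 (image_eq_zero_of_notMem_tsupport hzK)]

/-- Where `ρ` is locally one, `f` is forgotten entirely; this is how a modification smooths `f` or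
replaces it by another map. -/
lemma modify_eq_of_mem_core {f : M → N} {w : M → EuclideanSpace ℝ (Fin n)} {x : M}
    (hx : x ∈ P.core) : P.modify f w =ᶠ[𝓝 x] fun z ↦ P.chart.symm (w z) := by
  filter_upwards [hx, P.isOpen_core.mem_nhds hx] with z hz hzc
  rw [P.modify_of_mem (P.core_subset hzc), interp, hz]
  simp

/-- Modifying `f` towards `f'` does not change the points where both agree. -/
lemma modify_eq_of_eq {f f' : M → N} {x : M}
    (hf : ∀ x ∈ tsupport P.ρ, f x ∈ P.ball) (hx : f x = f' x) :
    P.modify f (fun z ↦ P.chart (f' z)) x = f' x := by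
  by_cases hxK : x ∈ tsupport P.ρ
  · have := (hf x hxK).1
    rw [P.modify_of_mem hxK, ← hx, P.interp_self this]
  · rw [P.modify_of_notMem hxK, hx]

lemma continuousAt_interp {X : Type*} [TopologicalSpace X] {a : X → M} {b : X → N}
    {w : X → EuclideanSpace ℝ (Fin n)} {x : X} (ha : ContinuousAt a x) (hb : ContinuousAt b x)
    (hw : ContinuousAt w x) (hbx : b x ∈ P.ball) (hwx : w x ∈ P.coordBall) :
    ContinuousAt (fun z ↦ P.interp (a z) (b z) (w z)) x := by
  have h1 : ContinuousAt (fun z ↦ P.ρ (a z)) x :=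
    ContinuousAt.comp (g := P.ρ) P.smooth.continuous.continuousAt ha
  have h2 : ContinuousAt (fun z ↦ P.chart (b z)) x :=
    ContinuousAt.comp (g := P.chart) (P.chart.continuousAt hbx.1) hb
  refine ContinuousAt.comp (g := P.chart.symm) (f := fun z ↦ (1 - P.ρ (a z)) • P.chart (b z) +
    P.ρ (a z) • w z) (P.chart.continuousAt_symm
      (P.coordBall_subset (P.interp_coord_mem hbx hwx))) ?_
  exact ((continuousAt_const.sub h1).smul h2).add (h1.smul hw)

lemma continuous_modify {f : M → N} (hf : Continuous f) {w : M → EuclideanSpace ℝ (Fin n)}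
    (hfB : ∀ x ∈ tsupport P.ρ, f x ∈ P.ball) (hw : ∀ x ∈ tsupport P.ρ, ContinuousAt w x)
    (hwB : ∀ x ∈ tsupport P.ρ, w x ∈ P.coordBall) : Continuous (P.modify f w) := by
  rw [continuous_iff_continuousAt]
  intro x
  by_cases hx : x ∈ tsupport P.ρ
  · exact (P.continuousAt_interp continuousAt_id hf.continuousAt (hw x hx) (hfB x hx)
      (hwB x hx)).congr (P.modify_eventuallyEq_interp hf.continuousAt (hfB x hx)).symm
  · exact hf.continuousAt.congr (P.modify_eventuallyEq hx).symm

variable [IsManifold (𝓡 n) ∞ N]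

/-- Smoothness has two sources: it is inherited where `f` is already smooth, and created on the
core, where only `w` matters. Successive modifications therefore never lose smooth points. -/
lemma contMDiffAt_modify {f : M → N} (hf : Continuous f) {w : M → EuclideanSpace ℝ (Fin n)}
    (hfB : ∀ x ∈ tsupport P.ρ, f x ∈ P.ball)
    (hwB : ∀ x ∈ tsupport P.ρ, w x ∈ P.coordBall) {x : M}
    (hw : x ∈ tsupport P.ρ → ContMDiffAt (𝓡 m) (𝓡 n) ∞ w x)
    (hx : ContMDiffAt (𝓡 m) (𝓡 n) ∞ f x ∨ x ∈ P.core) :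
    ContMDiffAt (𝓡 m) (𝓡 n) ∞ (P.modify f w) x := by
  by_cases hxK : x ∈ tsupport P.ρ
  · rcases hx with hx | hx
    · refine ContMDiffAt.congr_of_eventuallyEq ?_
        (P.modify_eventuallyEq_interp hf.continuousAt (hfB x hxK))
      have h1 : ContMDiffAt (𝓡 m) (𝓡 n) ∞ (fun z ↦ P.chart (f z)) x :=
        (contMDiffAt_chart (hfB x hxK).1).comp x hx
      have h2 : ContMDiffAt (𝓡 m) 𝓘(ℝ) ∞ (fun z ↦ 1 - P.ρ z) x :=
        contMDiffAt_const.sub P.smooth.contMDiffAt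
      have h3 : ContMDiffAt (𝓡 m) (𝓡 n) ∞
          (fun z ↦ (1 - P.ρ z) • P.chart (f z) + P.ρ z • w z) x :=
        (h2.smul h1).add (P.smooth.contMDiffAt.smul (hw hxK))
      exact (contMDiffAt_chart_symm (P.coordBall_subset
        (P.interp_coord_mem (hfB x hxK) (hwB x hxK)))).comp x h3
    · refine ContMDiffAt.congr_of_eventuallyEq ?_ (P.modify_eq_of_mem_core hx)
      exact (contMDiffAt_chart_symm (P.coordBall_subset (hwB x hxK))).comp x (hw hxK)
  · exact (hx.resolve_right fun h ↦ hxK (P.core_subset h)).congr_of_eventuallyEq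
      (P.modify_eventuallyEq hxK)

omit [IsManifold (𝓡 n) ∞ N]

variable [CompactSpace M]

lemma isCompact_tsupport : IsCompact (tsupport P.ρ) := (isClosed_tsupport P.ρ).isCompact

lemma eventually_mem_ball : ∀ᶠ f : C(M, N) in 𝓝 h, ∀ x ∈ tsupport P.ρ, f x ∈ P.ball :=
  ContinuousMap.eventually_mapsTo P.isCompact_tsupport P.isOpen_ball P.fits

variable [T2Space M]

lemma continuousAt_eval (f : C(M, N)) (x : M) :
    ContinuousAt (fun z : C(M, N) × M ↦ z.1 z.2) (f, x) :=
  continuous_eval.continuousAt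

lemma eventually_dist_lt {ε : ℝ} (hε : 0 < ε) :
    ∀ᶠ f : C(M, N) in 𝓝 h, ∀ x ∈ tsupport P.ρ, dist (P.chart (f x)) (P.chart (h x)) < ε := by
  refine P.isCompact_tsupport.eventually_forall_of_forall_eventually fun x hx ↦ ?_
  have h1 : ContinuousAt (fun z : C(M, N) × M ↦ P.chart (z.1 z.2)) (h, x) :=
    ContinuousAt.comp (g := P.chart) (P.chart.continuousAt (P.fits x hx).1)
      (continuousAt_eval h x)
  have h2 : ContinuousAt (fun z : C(M, N) × M ↦ P.chart (h z.2)) (h, x) :=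
    ContinuousAt.comp (g := P.chart) (P.chart.continuousAt (P.fits x hx).1)
      (h.continuous.comp continuous_snd).continuousAt
  have h3 := h1.dist h2
  exact h3.eventually_lt continuousAt_const (by simpa using hε)

/-- Modifications of maps close to `h` towards maps close to `h` are close to `h`. -/
lemma exists_nhds_modify_mem {O : Set C(M, N)} (hO : O ∈ 𝓝 h) :
    ∃ O' ∈ 𝓝 h, ∃ ε > 0, ∀ f ∈ O', ∀ w : M → EuclideanSpace ℝ (Fin n),
      (∀ x ∈ tsupport P.ρ, dist (w x) (P.chart (h x)) < ε) →
      ∀ F : C(M, N), ⇑F = P.modify f w → F ∈ O := by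
  -- The sets with the desired property form a filter, so it is enough to treat the subbasic sets of
  -- maps sending a compact `K` into an open `U`.
  let Q : Set C(M, N) → Prop := fun O ↦ ∃ O' ∈ 𝓝 h, ∃ ε > 0, ∀ f ∈ O',
    ∀ w : M → EuclideanSpace ℝ (Fin n),
      (∀ x ∈ tsupport P.ρ, dist (w x) (P.chart (h x)) < ε) →
      ∀ F : C(M, N), ⇑F = P.modify f w → F ∈ O
  let l : Filter C(M, N) :=
    { sets := {O | Q O}
      univ_sets := ⟨univ, univ_mem, 1, one_pos, fun _ _ _ _ _ _ ↦ mem_univ _⟩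
      sets_of_superset := by
        rintro A B ⟨O', hO', ε, hε, H⟩ hAB
        exact ⟨O', hO', ε, hε, fun f hf w hw F hF ↦ hAB (H f hf w hw F hF)⟩
      inter_sets := by
        rintro A B ⟨O₁, hO₁, ε₁, hε₁, H₁⟩ ⟨O₂, hO₂, ε₂, hε₂, H₂⟩
        exact ⟨O₁ ∩ O₂, inter_mem hO₁ hO₂, min ε₁ ε₂, lt_min hε₁ hε₂, fun f hf w hw F hF ↦
          ⟨H₁ f hf.1 w (fun x hx ↦ (hw x hx).trans_le (min_le_left _ _)) F hF,
            H₂ f hf.2 w (fun x hx ↦ (hw x hx).trans_le (min_le_right _ _)) F hF⟩⟩ }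
  suffices hl : Tendsto id l (𝓝 h) from hl hO
  rw [ContinuousMap.tendsto_nhds_compactOpen]
  intro K hK U hU hKU
  -- Treating the radius as a variable near `0` lets one compactness argument produce both the
  -- neighbourhood of `h` and a uniform radius.
  have key : ∀ᶠ z : C(M, N) × ℝ in 𝓝 (h, 0), ∀ x ∈ K ∩ tsupport P.ρ,
      ∀ v, dist v (P.chart (h x)) < z.2 → P.interp x (z.1 x) v ∈ U := by
    refine (hK.inter P.isCompact_tsupport).eventually_forall_of_forall_eventually fun x hx ↦ ?_
    have h1 : ContinuousAt (fun y : M × N × EuclideanSpace ℝ (Fin n) ↦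
        P.interp y.1 y.2.1 y.2.2) (x, h x, P.chart (h x)) :=
      P.continuousAt_interp continuousAt_fst (continuousAt_fst.comp continuousAt_snd)
        (continuousAt_snd.comp continuousAt_snd) (P.fits x hx.2) (P.fits x hx.2).2
    have h2 : ∀ᶠ y : M × N × EuclideanSpace ℝ (Fin n) in 𝓝 (x, h x, P.chart (h x)),
        P.interp y.1 y.2.1 y.2.2 ∈ U := by
      refine h1.preimage_mem_nhds (hU.mem_nhds ?_)
      change P.interp x (h x) (P.chart (h x)) ∈ U
      rw [P.interp_self (P.fits x hx.2).1]
      exact hKU hx.1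
    rw [nhds_prod_eq, nhds_prod_eq, ← Filter.eventually_map (m := fun p : M × N × _ ↦ p)
      (P := fun y ↦ P.interp y.1 y.2.1 y.2.2 ∈ U)] at h2
    obtain ⟨A, hA, D, hD, hAD⟩ := Filter.mem_prod_iff.1 h2
    obtain ⟨B, hB, V, hV, hBV⟩ := Filter.mem_prod_iff.1 hD
    obtain ⟨δ, hδ, hδV⟩ := Metric.mem_nhds_iff.1 hV
    have c1 : ∀ᶠ z : (C(M, N) × ℝ) × M in 𝓝 ((h, 0), x), z.2 ∈ A :=
      continuousAt_snd.preimage_mem_nhds hA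
    have c2 : ∀ᶠ z : (C(M, N) × ℝ) × M in 𝓝 ((h, 0), x), z.1.1 z.2 ∈ B := by
      have : Continuous fun z : (C(M, N) × ℝ) × M ↦ z.1.1 z.2 :=
        continuous_eval.comp ((continuous_fst.comp continuous_fst).prodMk continuous_snd)
      exact this.continuousAt.preimage_mem_nhds hB
    have c3 : ∀ᶠ z : (C(M, N) × ℝ) × M in 𝓝 ((h, 0), x), z.1.2 < δ / 2 :=
      (continuous_snd.comp continuous_fst).continuousAt.eventually_lt continuousAt_const
        (half_pos hδ)
    have c4 : ∀ᶠ z : (C(M, N) × ℝ) × M in 𝓝 ((h, 0), x),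
        dist (P.chart (h z.2)) (P.chart (h x)) < δ / 2 := by
      have c5 : ContinuousAt (fun z : (C(M, N) × ℝ) × M ↦ P.chart (h z.2)) ((h, 0), x) :=
        ContinuousAt.comp (g := P.chart) (P.chart.continuousAt (P.fits x hx.2).1)
          (h.continuous.comp continuous_snd).continuousAt
      exact (c5.dist continuousAt_const).eventually_lt continuousAt_const
        (by simpa using half_pos hδ)
    filter_upwards [c1, c2, c3, c4] with z z1 z2 z3 z4 v hv
    refine hAD (a := (z.2, z.1.1 z.2, v)) ⟨z1, hBV ⟨z2, hδV ?_⟩⟩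
    rw [Metric.mem_ball]
    linarith [dist_triangle v (P.chart (h z.2)) (P.chart (h x))]
  rw [nhds_prod_eq] at key
  obtain ⟨A, hA, D, hD, hAD⟩ := Filter.mem_prod_iff.1 key
  obtain ⟨δ, hδ, hδD⟩ := Metric.mem_nhds_iff.1 hD
  refine ⟨A ∩ {f | MapsTo f K U}, inter_mem hA (ContinuousMap.eventually_mapsTo hK hU hKU),
    δ / 2, half_pos hδ, fun f hf w hw F hF x hx ↦ ?_⟩
  rw [id, hF]
  by_cases hxK : x ∈ tsupport P.ρ
  · rw [P.modify_of_mem hxK]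
    refine hAD (a := (f, δ / 2)) ⟨hf.1, hδD ?_⟩ x ⟨hx, hxK⟩ (w x) (hw x hxK)
    rw [Metric.mem_ball, dist_zero_right, Real.norm_of_nonneg (half_pos hδ).le]
    exact half_lt_self hδ
  · rw [P.modify_of_notMem hxK]
    exact hf.2 hx

end Patch

end Patches

/-! ### Density of smooth maps and homotopy invariance. -/

section Homotopy

variable {m : ℕ} {M : Type*} [TopologicalSpace M] [ChartedSpace (EuclideanSpace ℝ (Fin m)) M]
variable {n : ℕ} {N : Type*} [TopologicalSpace N] [ChartedSpace (EuclideanSpace ℝ (Fin n)) N]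

variable (m n) in
/-- Two maps agree outside a compact subset of a chart domain, which both of them map into the same
coordinate ball. -/
def AgreeOffBall (f f' : M → N) : Prop :=
  ∃ (c : M) (p : N) (a : EuclideanSpace ℝ (Fin n)) (r R : ℝ) (K : Set M), 0 < r ∧ r < R ∧
    Metric.closedBall a R ⊆ (chartAt (EuclideanSpace ℝ (Fin n)) p).target ∧ IsCompact K ∧
    K ⊆ (chartAt (EuclideanSpace ℝ (Fin m)) c).source ∧ (∀ x ∉ K, f x = f' x) ∧
    (∀ x ∈ K, f x ∈ (chartAt (EuclideanSpace ℝ (Fin n)) p).source ∧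
      chartAt (EuclideanSpace ℝ (Fin n)) p (f x) ∈ Metric.ball a r) ∧
    (∀ x ∈ K, f' x ∈ (chartAt (EuclideanSpace ℝ (Fin n)) p).source ∧
      chartAt (EuclideanSpace ℝ (Fin n)) p (f' x) ∈ Metric.ball a r)

lemma Patch.agreeOffBall_modify [CompactSpace M] {h : C(M, N)} (P : Patch m n h) {f : M → N}
    {w : M → EuclideanSpace ℝ (Fin n)} (hf : ∀ x ∈ tsupport P.ρ, f x ∈ P.ball)
    (hw : ∀ x ∈ tsupport P.ρ, w x ∈ P.coordBall) : AgreeOffBall m n f (P.modify f w) := by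
  refine ⟨P.base, P.ctr, P.chart P.ctr, P.r, P.R, tsupport P.ρ, P.r_pos, P.r_lt,
    P.closedBall_subset, P.isCompact_tsupport, P.tsupport_subset,
    fun x hx ↦ (P.modify_of_notMem hx).symm, hf, fun x hx ↦ ?_⟩
  rw [P.modify_of_mem hx]
  exact P.interp_mem (hf x hx) (hw x hx)

variable [IsManifold (𝓡 m) ∞ M] [IsManifold (𝓡 n) ∞ N] [CompactSpace M] [T2Space M]

-- A smooth bump function at `x` with small enough support serves as cutoff. Halving the radius
-- leaves the room between `r` and `R` that the Poincaré lemma needs for its own cutoff.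
omit [IsManifold (𝓡 n) ∞ N] [CompactSpace M] in
lemma exists_patch (h : C(M, N)) (x : M) : ∃ P : Patch m n h, x ∈ P.core := by
  let e : OpenPartialHomeomorph N (EuclideanSpace ℝ (Fin n)) := chartAt _ (h x)
  have hx : h x ∈ e.source := mem_chart_source _ (h x)
  obtain ⟨R, hR, hball⟩ := Metric.nhds_basis_closedBall.mem_iff.1
    (e.open_target.mem_nhds (e.map_source hx))
  have hB : IsOpen (e.source ∩ e ⁻¹' Metric.ball (e (h x)) (R / 2)) :=
    e.isOpen_inter_preimage Metric.isOpen_ball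
  have hU : h ⁻¹' (e.source ∩ e ⁻¹' Metric.ball (e (h x)) (R / 2)) ∈ 𝓝 x :=
    h.continuous.continuousAt.preimage_mem_nhds
      (hB.mem_nhds ⟨hx, Metric.mem_ball_self (half_pos hR)⟩)
  obtain ⟨b, -, hb⟩ := (SmoothBumpFunction.nhds_basis_tsupport (I := 𝓡 m) x).mem_iff.1 hU
  exact ⟨⟨x, h x, R / 2, R, half_pos hR, half_lt_self hR, hball, b, b.contMDiff,
    fun _ ↦ b.mem_Icc, b.tsupport_subset_chartAt_source, fun y hy ↦ hb hy⟩, b.eventuallyEq_one⟩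

omit [IsManifold (𝓡 n) ∞ N] in
lemma exists_finset_patch (h : C(M, N)) :
    ∃ s : Finset M, ∃ P : M → Patch m n h, ⋃ x ∈ s, (P x).core = univ := by
  choose P hP using exists_patch (m := m) (n := n) h
  obtain ⟨s, hs⟩ := isCompact_univ.elim_finite_subcover (fun x ↦ (P x).core)
    (fun x ↦ (P x).isOpen_core) fun x _ ↦ mem_iUnion.2 ⟨x, hP x⟩
  exact ⟨s, P, univ_subset_iff.1 hs⟩

/-- Smooth maps are dense among continuous maps. -/
theorem exists_contMDiff_mem_nhds (h : C(M, N)) {O : Set C(M, N)} (hO : O ∈ 𝓝 h) :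
    ∃ f ∈ O, ContMDiff (𝓡 m) (𝓡 n) ∞ f := by
  obtain ⟨s, P, hs⟩ := exists_finset_patch (m := m) (n := n) h
  -- Smoothing proceeds patch by patch. Quantifying over all neighbourhoods `O` lets each stage
  -- demand as much closeness to `h` as the next one requires.
  suffices H : ∀ t : Finset M, ∀ O ∈ 𝓝 h, ∃ f ∈ O, ∀ x ∈ ⋃ y ∈ t, (P y).core,
      ContMDiffAt (𝓡 m) (𝓡 n) ∞ f x by
    obtain ⟨f, hf, hfs⟩ := H s O hO
    exact ⟨f, hf, fun x ↦ hfs x (hs ▸ mem_univ x)⟩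
  intro t
  classical
  induction t using Finset.induction_on with
  | empty => exact fun O hO ↦ ⟨h, mem_of_mem_nhds hO, by simp⟩
  | insert a t _ ih =>
    intro O hO
    obtain ⟨O', hO', ε, hε, H⟩ := (P a).exists_nhds_modify_mem hO
    obtain ⟨f, ⟨hfO, hfB⟩, hf⟩ := ih _ (inter_mem hO' (P a).eventually_mem_ball)
    let D : M → Set (EuclideanSpace ℝ (Fin n)) := fun x ↦ {v | x ∈ tsupport (P a).ρ →
      v ∈ Metric.ball ((P a).chart (h x)) ε ∩ (P a).coordBall}
    obtain ⟨w, hw⟩ : ∃ w : C^∞⟮𝓡 m, M; 𝓡 n, EuclideanSpace ℝ (Fin n)⟯, ∀ x, w x ∈ D x := by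
      refine exists_contMDiffMap_forall_mem_convex_of_local_const (𝓡 m) (fun x ↦ ?_) fun x ↦ ?_
      · exact ((convex_ball _ _).inter (convex_ball _ _)).setOfPred_const_imp
      · refine ⟨(P a).chart (h x), ?_⟩
        by_cases hx : x ∈ tsupport (P a).ρ
        · have hc : ContinuousAt (fun y ↦ (P a).chart (h y)) x :=
            ContinuousAt.comp (g := (P a).chart) ((P a).chart.continuousAt ((P a).fits x hx).1)
              h.continuous.continuousAt
          filter_upwards [(continuousAt_const.dist hc).eventually_lt continuousAt_const
            (show dist ((P a).chart (h x)) ((P a).chart (h x)) < ε by simpa using hε)] with y hy _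
          exact ⟨hy, ((P a).fits x hx).2⟩
        · filter_upwards [(isClosed_tsupport (P a).ρ).isOpen_compl.mem_nhds hx] with y hy hy'
          exact absurd hy' hy
    have hwB : ∀ x ∈ tsupport (P a).ρ, w x ∈ (P a).coordBall := fun x hx ↦ (hw x hx).2
    have hc : Continuous ((P a).modify f w) := (P a).continuous_modify f.continuous hfB
      (fun x _ ↦ w.contMDiff.continuous.continuousAt) hwB
    refine ⟨⟨_, hc⟩, H f hfO w (fun x hx ↦ (hw x hx).1) _ rfl, fun x hx ↦ ?_⟩
    refine (P a).contMDiffAt_modify f.continuous hfB hwB (fun _ ↦ w.contMDiff.contMDiffAt) ?_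
    rw [Finset.set_biUnion_insert] at hx
    exact hx.symm.imp_left (hf x)

variable {X : Type*} {T : C(M, N) → X}

/-- A function of smooth maps, invariant under modifications on coordinate balls, is locally
constant in the compact-open topology. -/
theorem exists_nhds_eq (hT : ∀ f f' : C(M, N), ContMDiff (𝓡 m) (𝓡 n) ∞ f →
      ContMDiff (𝓡 m) (𝓡 n) ∞ f' → AgreeOffBall m n f f' → T f = T f') (h : C(M, N)) :
    ∃ O ∈ 𝓝 h, ∀ f ∈ O, ∀ f' ∈ O, ContMDiff (𝓡 m) (𝓡 n) ∞ f → ContMDiff (𝓡 m) (𝓡 n) ∞ f' →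
      T f = T f' := by
  obtain ⟨s, P, hs⟩ := exists_finset_patch (m := m) (n := n) h
  -- `f` is moved to `f'` one patch at a time: `F` agrees with `f'` on the cores treated so far and
  -- has the same `T` as `f`. Once the cores cover `M`, `F` is `f'`.
  suffices H : ∀ t : Finset M, ∀ O ∈ 𝓝 h, ∃ O' ∈ 𝓝 h, ∀ f ∈ O', ∀ f' ∈ O',
      ContMDiff (𝓡 m) (𝓡 n) ∞ f → ContMDiff (𝓡 m) (𝓡 n) ∞ f' → ∃ F ∈ O,
        ContMDiff (𝓡 m) (𝓡 n) ∞ F ∧ T F = T f ∧ ∀ x ∈ ⋃ y ∈ t, (P y).core, F x = f' x by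
    obtain ⟨O, hO, H⟩ := H s univ univ_mem
    refine ⟨O, hO, fun f hf f' hf' hfs hfs' ↦ ?_⟩
    obtain ⟨F, -, -, hTF, hF⟩ := H f hf f' hf' hfs hfs'
    rw [← hTF]
    congr 1
    ext x
    exact hF x (hs ▸ mem_univ x)
  intro t
  classical
  induction t using Finset.induction_on with
  | empty => exact fun O hO ↦ ⟨O, hO, fun f hf f' _ hfs _ ↦ ⟨f, hf, hfs, rfl, by simp⟩⟩
  | insert a t _ ih =>
    intro O hO
    obtain ⟨O₁, hO₁, ε, hε, H₁⟩ := (P a).exists_nhds_modify_mem hO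
    obtain ⟨O₂, hO₂, H₂⟩ := ih _ (inter_mem hO₁ (P a).eventually_mem_ball)
    refine ⟨O₂ ∩ ({f | ∀ x ∈ tsupport (P a).ρ, f x ∈ (P a).ball} ∩
      {f | ∀ x ∈ tsupport (P a).ρ, dist ((P a).chart (f x)) ((P a).chart (h x)) < ε}),
      inter_mem hO₂ (inter_mem (P a).eventually_mem_ball ((P a).eventually_dist_lt hε)),
      fun f hf f' hf' hfs hfs' ↦ ?_⟩
    obtain ⟨G, ⟨hGO, hGB⟩, hGs, hTG, hG⟩ := H₂ f hf.1 f' hf'.1 hfs hfs'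
    have hwB : ∀ x ∈ tsupport (P a).ρ, (P a).chart (f' x) ∈ (P a).coordBall := fun x hx ↦
      (hf'.2.1 x hx).2
    have hws : ∀ x ∈ tsupport (P a).ρ,
        ContMDiffAt (𝓡 m) (𝓡 n) ∞ (fun z ↦ (P a).chart (f' z)) x := fun x hx ↦
      (contMDiffAt_chart (hf'.2.1 x hx).1).comp x (hfs' x)
    have hFs : ContMDiff (𝓡 m) (𝓡 n) ∞ ((P a).modify G fun z ↦ (P a).chart (f' z)) := fun x ↦
      (P a).contMDiffAt_modify G.continuous hGB hwB (hws x) (Or.inl (hGs x))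
    let F : C(M, N) := ⟨_, hFs.continuous⟩
    refine ⟨F, H₁ G hGO _ hf'.2.2 F rfl, hFs, ?_, fun x hx ↦ ?_⟩
    · rw [← hTG]
      exact (hT G F hGs hFs ((P a).agreeOffBall_modify hGB hwB)).symm
    · rw [Finset.set_biUnion_insert] at hx
      rcases hx with hx | hx
      · have h1 := ((P a).modify_eq_of_mem_core (f := G) (w := fun z ↦ (P a).chart (f' z))
          hx).self_of_nhds
        exact h1.trans ((P a).chart.left_inv (hf'.2.1 x ((P a).core_subset hx)).1)
      · exact (P a).modify_eq_of_eq hGB (hG x hx)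

/-- A function of smooth maps, invariant under modifications on coordinate balls, is invariant
under continuous homotopies. -/
theorem eq_of_homotopic (hT : ∀ f f' : C(M, N), ContMDiff (𝓡 m) (𝓡 n) ∞ f →
      ContMDiff (𝓡 m) (𝓡 n) ∞ f' → AgreeOffBall m n f f' → T f = T f') {φ ψ : C(M, N)}
    (hφ : ContMDiff (𝓡 m) (𝓡 n) ∞ φ) (hψ : ContMDiff (𝓡 m) (𝓡 n) ∞ ψ)
    (h : φ.Homotopic ψ) : T φ = T ψ := by
  obtain ⟨H⟩ := h
  choose O hO hTO using exists_nhds_eq hT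
  choose S hSO hS using fun h ↦ exists_contMDiff_mem_nhds (m := m) (n := n) h (hO h)
  -- Intermediate stages are only continuous, so `T` is evaluated on a chosen smooth approximation
  -- `S` of each.
  have hloc : IsLocallyConstant fun t : unitInterval ↦ T (S (H.curry t)) := by
    rw [IsLocallyConstant.iff_eventually_eq]
    intro t
    have h1 : ∀ᶠ s in 𝓝 t, H.curry s ∈ interior (O (H.curry t)) :=
      H.curry.continuous.continuousAt.preimage_mem_nhds (interior_mem_nhds.2 (hO _))
    filter_upwards [h1] with s hs
    -- A smooth map lying in the good neighbourhoods of both stages links the two approximations.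
    obtain ⟨f, ⟨hf1, hf2⟩, hf⟩ := exists_contMDiff_mem_nhds (m := m) (n := n) (H.curry s)
      (inter_mem (hO _) (mem_interior_iff_mem_nhds.1 hs))
    exact (hTO _ _ (hSO _) f hf1 (hS _) hf).trans (hTO _ f hf2 _ (hSO _) hf (hS _))
  have h0 : H.curry 0 = φ := by ext x; simp
  have h1 : H.curry 1 = ψ := by ext x; simp
  have key := hloc.apply_eq_of_preconnectedSpace 0 1
  simp only [h0, h1] at key
  rw [hTO φ φ (mem_of_mem_nhds (hO φ)) _ (hSO φ) hφ (hS φ), key,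
    hTO ψ _ (hSO ψ) ψ (mem_of_mem_nhds (hO ψ)) (hS ψ) hψ]

end Homotopy

/-- A smooth map pulling back the symplectic form to a coclosed form minimizes the energy in its
homotopy class. -/
theorem energy_le_of_isCoclosed {m n : ℕ}
    {M : Type*} [TopologicalSpace M] [ChartedSpace (EuclideanSpace ℝ (Fin m)) M]
    [IsManifold (𝓡 m) ∞ M] [T2Space M] [CompactSpace M] [MeasurableSpace M] [BorelSpace M]
    {N : Type*} [TopologicalSpace N] [ChartedSpace (EuclideanSpace ℝ (Fin n)) N]
    [IsManifold (𝓡 n) ∞ N] [T2Space N]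
    (g : RiemannianMetric m M) (Ω : SymplecticForm n N)
    (φ : C^∞⟮𝓡 m, M; 𝓡 n, N⟯)
    (hφ : IsCoclosed g (Ω.form.pullback φ))
    (ψ : C^∞⟮𝓡 m, M; 𝓡 n, N⟯)
    (hψ : ContinuousMap.Homotopic (φ : C(M, N)) (ψ : C(M, N))) :
    energy g Ω φ ≤ energy g Ω ψ := by
  have hcoord : ∀ f : M → N, ContMDiff (𝓡 m) (𝓡 n) ∞ f → ∀ c i j,
      ContDiffOn ℝ ∞ (fun y ↦ formCoord (Ω.form.pullback f) c y i j)
        (chartAt (EuclideanSpace ℝ (Fin m)) c).target := fun f hf c i j ↦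
    contDiffOn_formCoord_pullback Ω.isSmooth hf c i j
  have hint : ∀ f f' : M → N, ContMDiff (𝓡 m) (𝓡 n) ∞ f → ContMDiff (𝓡 m) (𝓡 n) ∞ f' →
      Integrable (formInner g (Ω.form.pullback f) (Ω.form.pullback f')) (riemannianVolume g) :=
    fun f f' hf hf' ↦ (continuous_formInner g (fun c i j ↦ (hcoord f hf c i j).of_le (by simp))
      (fun c i j ↦ (hcoord f' hf' c i j).of_le (by simp))).integrable_of_hasCompactSupport
        (HasCompactSupport.of_compactSpace _)
  -- Orthogonality of `φ^*ω` to `ψ^*ω - φ^*ω`: the pairing of the fixed form `φ^*ω` with `f^*ω` is a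
  -- homotopy invariant of `f`.
  have hT : ∫ x, formInner g (Ω.form.pullback φ) (Ω.form.pullback φ) x ∂(riemannianVolume g) =
      ∫ x, formInner g (Ω.form.pullback φ) (Ω.form.pullback ψ) x ∂(riemannianVolume g) := by
    refine eq_of_homotopic (m := m) (n := n) (φ := (φ : C(M, N))) (ψ := (ψ : C(M, N)))
      (T := fun f : C(M, N) ↦ ∫ x, formInner g (Ω.form.pullback φ) (Ω.form.pullback f) x
        ∂(riemannianVolume g)) ?_ φ.contMDiff ψ.contMDiff hψ
    rintro f f' hf hf' ⟨c, p, a, r, R, K, hr, hrR, hR, hK, hKc, heq, hfK, hfK'⟩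
    exact integral_formInner_pullback_eq g hφ (hcoord φ φ.contMDiff) Ω hf hf' hr hrR hR hK hKc
      heq hfK hfK'
  have hφφ := hint φ φ φ.contMDiff φ.contMDiff
  have hφψ := hint φ ψ φ.contMDiff ψ.contMDiff
  have hψψ := hint ψ ψ ψ.contMDiff ψ.contMDiff
  have hsub : Integrable (fun x ↦ 2 * (formInner g (Ω.form.pullback φ) (Ω.form.pullback ψ) x -
      formInner g (Ω.form.pullback φ) (Ω.form.pullback φ) x)) (riemannianVolume g) :=
    (hφψ.sub hφφ).const_mul 2
  have hle := integral_mono (hφφ.add hsub) hψψ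
    (normSq_add_le g (Ω.form.pullback φ) (Ω.form.pullback ψ))
  have heq : ∫ x, (formInner g (Ω.form.pullback φ) (Ω.form.pullback φ) x +
      2 * (formInner g (Ω.form.pullback φ) (Ω.form.pullback ψ) x -
        formInner g (Ω.form.pullback φ) (Ω.form.pullback φ) x)) ∂(riemannianVolume g) =
      ∫ x, formInner g (Ω.form.pullback φ) (Ω.form.pullback φ) x ∂(riemannianVolume g) := by
    rw [integral_add hφφ hsub, integral_const_mul, integral_sub hφψ hφφ, hT]
    ring
  exact mul_le_mul_of_nonneg_left (heq.symm.le.trans hle) (by norm_num)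

end SymplecticDirichlet

end

open SymplecticDirichlet in
theorem mainTheorem2 {m n : ℕ}
    {M : Type*} [TopologicalSpace M] [ChartedSpace (EuclideanSpace ℝ (Fin m)) M]
    [IsManifold (𝓡 m) ∞ M] [T2Space M] [CompactSpace M] [MeasurableSpace M] [BorelSpace M]
    {N : Type*} [TopologicalSpace N] [ChartedSpace (EuclideanSpace ℝ (Fin n)) N]
    [IsManifold (𝓡 n) ∞ N] [T2Space N]
    (g : RiemannianMetric m M) (Ω : SymplecticForm n N)
    (φ : C^∞⟮𝓡 m, M; 𝓡 n, N⟯)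
    (hφ : IsCoclosed g (Ω.form.pullback φ))
    (ψ : C^∞⟮𝓡 m, M; 𝓡 n, N⟯)
    (hψ : ContinuousMap.Homotopic (φ : C(M, N)) (ψ : C(M, N))) :
    energy g Ω φ ≤ energy g Ω ψ :=
  energy_le_of_isCoclosed g Ω φ hφ ψ hψ
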